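/- Let $z,z'\in\mathbb C$ satisfy one of the following: (i) $z'=\bar z$ and $z\notin\mathbb Z$; (ii) $z,z'$ are real and $m<z,z'<m+1$ for some $m\in\mathbb Z$. Put $$a=\tfrac{z+z'}2,\qquad \mu=\tfrac{z-z'}2,\qquad \sigma=\sqrt{\sin(\pi z)\sin(\pi z')}>0,\qquad c=\frac{2\mu\sigma^2}{\pi\sin(2\pi\mu)}>0 .$$ Let $W_{\kappa,\mu}$ be the Whittaker function on $(0,\infty)$, i.e. the only solution of $y''-\bigl(\frac14-\frac{\kappa}{x}+\frac{\mu^2-1/4}{x^2}\bigr)y=0$ with $y(x)\sim x^{\kappa}e^{-x/2}$ as $x\to+\infty$, and put $$A_\pm(x)=x^{-1/2}W_{\pm a+\frac12,\mu}(x),\qquad B_\pm(x)=x^{-1/2}W_{\pm a-\frac12,\mu}(x).$$ The matrix Whittaker kernel is $K=\begin{bmatrix}K_{++}&K_{+-}\\K_{-+}&K_{--}\end{bmatrix}$, where for $x,y>0$ $$K_{++}(x,y)=\frac{1}{\Gamma(z)\Gamma(z')}\,\frac{A_+(x)B_+(y)-B_+(x)A_+(y)}{x-y},\qquad K_{--}(x,y)=\frac{1}{\Gamma(-z)\Gamma(-z')}\,\frac{A_-(x)B_-(y)-B_-(x)A_-(y)}{x-y},$$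 $$K_{+-}(x,y)=\frac{\sigma}{\pi}\,\frac{A_+(x)A_-(y)+zz'B_+(x)B_-(y)}{x+y},\qquad K_{-+}(x,y)=-K_{+-}(y,x),$$ with $K_{++}$, $K_{--}$ extended to $x=y$ by continuity. Let $K'(\xi,\eta)=\frac{\sqrt{xy}}{c}\,K(x,y)$, $x=e^{-\xi/c}$, $y=e^{-\eta/c}$, be the kernel on $\mathbb R$ obtained from $K$ by the change of variable $x\mapsto\xi=-c\ln x$ on each copy of $\mathbb R_+$. Then for all $\xi,\eta\in\mathbb R$ the limit $\lim_{M\to+\infty}K'(\xi+M,\eta+M)=\mathcal K(\xi,\eta)$ exists. The kernel $\mathcal K$ is translation invariant, its diagonal blocks satisfy $\mathcal K_{++}(\xi,\xi)=\mathcal K_{--}(\xi,\xi)=1$, and $$\mathcal K(\xi,\eta)=\begin{bmatrix}F(\xi-\eta)&G(\xi-\eta)\\-G(\eta-\xi)&F(\xi-\eta)\end{bmatrix},$$ $$F(\zeta)=\frac BA\,\frac{\sinh(A\zeta)}{\sinh(B\zeta)},\qquad G(\zeta)=\frac{1}{2\mu\sigma}\,\frac{\sin(\pi\mu)\cos(\pi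 a)\cosh(A\zeta)-\sin(\pi a)\cos(\pi\mu)\sinh(A\zeta)}{\cosh(B\zeta)},$$ where $$B=\frac{\pi\sin(2\pi\mu)}{4\mu\sigma^2}>0,\qquad A=2\mu B=\frac{\pi\sin(2\pi\mu)}{2\sigma^2}.$$ Here $F(0)=1$, and for $\mu=0$ (that is, $z=z'$) the expressions are understood as their limits as $\mu\to0$: $c=\sigma^2/\pi^2$, $B=\pi^2/(2\sigma^2)$, $A=0$, $F(\zeta)=B\zeta/\sinh(B\zeta)$ and $G(\zeta)=\frac1{2\sigma}\,\frac{\pi\cos(\pi a)-2B\zeta\sin(\pi a)}{\cosh(B\zeta)}$. -/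

import Mathlib

open Filter Topology Asymptotics

noncomputable section

namespace WhittakerTail

/-- `y` solves Whittaker's equation
`y'' - (1/4 - κ/x + (μ² - 1/4)/x²) y = 0` on `(0, ∞)` and `y(x) ∼ x^κ e^{-x/2}` as `x → +∞`. -/
structure IsWhittakerW (κ μ : ℂ) (y : ℝ → ℂ) : Prop where
  differentiable : ∀ x : ℝ, 0 < x → DifferentiableAt ℝ y x
  differentiable_deriv : ∀ x : ℝ, 0 < x → DifferentiableAt ℝ (deriv y) x
  equation : ∀ x : ℝ, 0 < x →
    deriv (deriv y) x - (1 / 4 - κ / (x : ℂ) + (μ ^ 2 - 1 / 4) / (x : ℂ) ^ 2) * y x = 0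
  asymptotics : y ~[atTop] fun x : ℝ => (x : ℂ) ^ κ * Complex.exp (-(x : ℂ) / 2)

/-- The Whittaker function `W_{κ,μ}` on `(0, ∞)`: the only solution (on `(0, ∞)`) of Whittaker's
equation with `W_{κ,μ}(x) ∼ x^κ e^{-x/2}` as `x → +∞`. Only its values on `(0, ∞)` are meaningful
and only these are used. -/
def whittakerW (κ μ : ℂ) : ℝ → ℂ :=
  Classical.epsilon (IsWhittakerW κ μ)

/-- The admissible parameters: either `z' = conj z` with `z` not an integer, or `z`, `z'` are real
and lie in a common open interval `(m, m + 1)` with `m` an integer. -/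
def Admissible (z z' : ℂ) : Prop :=
  (z' = (starRingEnd ℂ) z ∧ ∀ m : ℤ, z ≠ (m : ℂ)) ∨
  (∃ r r' : ℝ, z = (r : ℂ) ∧ z' = (r' : ℂ) ∧
    ∃ m : ℤ, (m : ℝ) < r ∧ r < m + 1 ∧ (m : ℝ) < r' ∧ r' < m + 1)

/-- `a = (z + z') / 2`. -/
def parA (z z' : ℂ) : ℂ := (z + z') / 2

/-- `μ = (z - z') / 2`. -/
def parMu (z z' : ℂ) : ℂ := (z - z') / 2

/-- `sin (π z) sin (π z')`, which is a positive real number for admissible parameters. -/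
def sinProd (z z' : ℂ) : ℂ := Complex.sin (Real.pi * z) * Complex.sin (Real.pi * z')

/-- `σ = √(sin (π z) sin (π z')) > 0`. -/
def sigma (z z' : ℂ) : ℝ := Real.sqrt (sinProd z z').re

/-- `A₊(x) = x^{-1/2} W_{a+1/2,μ}(x)`. -/
def Aplus (z z' : ℂ) (x : ℝ) : ℂ :=
  ((Real.sqrt x)⁻¹ : ℝ) * whittakerW (parA z z' + 1 / 2) (parMu z z') x

/-- `A₋(x) = x^{-1/2} W_{-a+1/2,μ}(x)`. -/
def Aminus (z z' : ℂ) (x : ℝ) : ℂ :=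
  ((Real.sqrt x)⁻¹ : ℝ) * whittakerW (-parA z z' + 1 / 2) (parMu z z') x

/-- `B₊(x) = x^{-1/2} W_{a-1/2,μ}(x)`. -/
def Bplus (z z' : ℂ) (x : ℝ) : ℂ :=
  ((Real.sqrt x)⁻¹ : ℝ) * whittakerW (parA z z' - 1 / 2) (parMu z z') x

/-- `B₋(x) = x^{-1/2} W_{-a-1/2,μ}(x)`. -/
def Bminus (z z' : ℂ) (x : ℝ) : ℂ :=
  ((Real.sqrt x)⁻¹ : ℝ) * whittakerW (-parA z z' - 1 / 2) (parMu z z') x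

/-- `(f(x) g(y) - g(x) f(y)) / (x - y)`, extended to `x = y` by continuity. -/
def divDiffKernel (f g : ℝ → ℂ) (x y : ℝ) : ℂ :=
  if x = y then deriv f x * g x - deriv g x * f x
  else (f x * g y - g x * f y) / ((x : ℂ) - (y : ℂ))

/-- The block `K₊₊` of the matrix Whittaker kernel. -/
def Kpp (z z' : ℂ) (x y : ℝ) : ℂ :=
  1 / (Complex.Gamma z * Complex.Gamma z') * divDiffKernel (Aplus z z') (Bplus z z') x y

/-- The block `K₊₋` of the matrix Whittaker kernel. -/
def Kpm (z z' : ℂ) (x y : ℝ) : ℂ :=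
  (sigma z z' : ℂ) / (Real.pi : ℂ) *
    ((Aplus z z' x * Aminus z z' y + z * z' * (Bplus z z' x * Bminus z z' y)) /
      ((x : ℂ) + (y : ℂ)))

/-- The block `K₋₊` of the matrix Whittaker kernel. -/
def Kmp (z z' : ℂ) (x y : ℝ) : ℂ :=
  -((sigma z z' : ℂ) / (Real.pi : ℂ)) *
    ((Aplus z z' y * Aminus z z' x + z * z' * (Bplus z z' y * Bminus z z' x)) /
      ((x : ℂ) + (y : ℂ)))

/-- The block `K₋₋` of the matrix Whittaker kernel. -/
def Kmm (z z' : ℂ) (x y : ℝ) : ℂ :=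
  1 / (Complex.Gamma (-z) * Complex.Gamma (-z')) *
    divDiffKernel (Aminus z z') (Bminus z z') x y

/-- The matrix Whittaker kernel on two copies of `(0, ∞)`; index `0` is `+`, index `1` is `-`. -/
def whittakerKernel (z z' : ℂ) (x y : ℝ) : Matrix (Fin 2) (Fin 2) ℂ :=
  !![Kpp z z' x y, Kpm z z' x y;
     Kmp z z' x y, Kmm z z' x y]

/-- `2 μ σ² / (π sin (2πμ))`, with its limit value `σ² / π²` at `μ = 0`. -/
def scaleComplex (z z' : ℂ) : ℂ :=
  if parMu z z' = 0 then (sigma z z' : ℂ) ^ 2 / (Real.pi : ℂ) ^ 2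
  else 2 * parMu z z' * (sigma z z' : ℂ) ^ 2 /
    ((Real.pi : ℂ) * Complex.sin (2 * Real.pi * parMu z z'))

/-- The constant `c`: `scaleComplex` is a positive real number for admissible parameters. -/
def scale (z z' : ℂ) : ℝ := (scaleComplex z z').re

/-- The inverse `ξ ↦ x = e^{-ξ/c}` of the change of variable `x ↦ ξ = -c ln x`. -/
def expVar (c ξ : ℝ) : ℝ := Real.exp (-ξ / c)

/-- The matrix Whittaker kernel in the variables `ξ = -c ln x`, `η = -c ln y`:
`K'(ξ, η) = |dx/dξ|^{1/2} |dy/dη|^{1/2} K(x, y)`, where `|dx/dξ| = x / c`. -/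
def whittakerKernelLog (z z' : ℂ) (ξ η : ℝ) : Matrix (Fin 2) (Fin 2) ℂ :=
  ((Real.sqrt (expVar (scale z z') ξ / scale z z') *
      Real.sqrt (expVar (scale z z') η / scale z z') : ℝ) : ℂ) •
    whittakerKernel z z' (expVar (scale z z') ξ) (expVar (scale z z') η)

/-- `π sin (2πμ) / (4 μ σ²)`, with its limit value `π² / (2 σ²)` at `μ = 0`. -/
def constBComplex (z z' : ℂ) : ℂ :=
  if parMu z z' = 0 then (Real.pi : ℂ) ^ 2 / (2 * (sigma z z' : ℂ) ^ 2)
  else (Real.pi : ℂ) * Complex.sin (2 * Real.pi * parMu z z') /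
    (4 * parMu z z' * (sigma z z' : ℂ) ^ 2)

/-- The constant `B`: `constBComplex` is a positive real number for admissible parameters. -/
def constB (z z' : ℂ) : ℝ := (constBComplex z z').re

/-- The constant `A = π sin (2πμ) / (2 σ²)`, which is real or purely imaginary. -/
def constA (z z' : ℂ) : ℂ :=
  (Real.pi : ℂ) * Complex.sin (2 * Real.pi * parMu z z') / (2 * (sigma z z' : ℂ) ^ 2)

/-- `F(ζ) = (B/A) sinh(Aζ) / sinh(Bζ)`, with the limit values `1` at `ζ = 0` and
`Bζ / sinh(Bζ)` when `μ = 0` (then `A = 0`). -/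
def tailF (z z' : ℂ) (ζ : ℝ) : ℂ :=
  if ζ = 0 then 1
  else if parMu z z' = 0 then
    (constB z z' : ℂ) * ζ / Complex.sinh (constB z z' * ζ)
  else (constB z z' : ℂ) / constA z z' *
    (Complex.sinh (constA z z' * ζ) / Complex.sinh (constB z z' * ζ))

/-- `G(ζ) = (1/(2μσ)) (sin(πμ) cos(πa) cosh(Aζ) - sin(πa) cos(πμ) sinh(Aζ)) / cosh(Bζ)`, with the
limit value `(1/(2σ)) (π cos(πa) - 2Bζ sin(πa)) / cosh(Bζ)` when `μ = 0`. -/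
def tailG (z z' : ℂ) (ζ : ℝ) : ℂ :=
  if parMu z z' = 0 then
    1 / (2 * (sigma z z' : ℂ)) *
      (((Real.pi : ℂ) * Complex.cos (Real.pi * parA z z')
        - 2 * (constB z z' : ℂ) * ζ * Complex.sin (Real.pi * parA z z'))
        / Complex.cosh (constB z z' * ζ))
  else
    1 / (2 * parMu z z' * (sigma z z' : ℂ)) *
      ((Complex.sin (Real.pi * parMu z z') * Complex.cos (Real.pi * parA z z')
            * Complex.cosh (constA z z' * ζ)
        - Complex.sin (Real.pi * parA z z') * Complex.cos (Real.pi * parMu z z')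
            * Complex.sinh (constA z z' * ζ))
        / Complex.cosh (constB z z' * ζ))

end WhittakerTail

end

noncomputable section

namespace WhittakerTail

open MeasureTheory Set

/-! As `M` grows, `x` and `y` tend to zero with the ratio `x / y = e^{-(ξ-η)/c}` fixed, and `√(xy) /
(x ∓ y)` depends on that ratio alone. Everything therefore reduces to the behaviour at zero of
`A_±`, `B_±` inside bilinear forms.

For `μ ≠ 0` the leading part at zero of `x^{-1/2} W_{a+1/2,μ}` is `Γ(-2μ)/Γ(-μ-a) x^μ + Γ(2μ)/Γ(μ-a)
x^{-μ}`, with error `O(x^{1/2})`; for `μ = 0` a logarithm appears. Admissibility forces `|Re μ| <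
1/2`, so the leading parts are `o(x^{-1/2})` and the errors disappear from every product.

At zero the first order system for `(A, B)` becomes the Euler system `xA' = aA + zz'B`, `xB' = -A -
aB`. The forms `A(x)B(y) - B(x)A(y)`, and `A₊(x)A₋(y) + zz'B₊(x)B₋(y)` for the systems of `a` and
`-a`, are invariant under its common dilations. On leading parts they are thus combinations of
`cosh` and `sinh` of `μ (log x - log y)` (`zeroMain_wronskian`, `zeroMain_cross`). Their
coefficients come from the reflection formula (`coef_disc`, `coef_crossC`, `coef_crossS`), and
`coef_disc` produces exactly the scale `c`, hence the value 1 on the diagonal.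

Because `whittakerW` is chosen by `epsilon`, existence and uniqueness are both needed. Uniqueness
comes from the Wronskian at infinity. Existence comes from a Laplace integral when `Re (μ - a) ≥ 2`,
followed by a contiguous relation raising `a` by one, which preserves all properties in
`WhittakerPair`. The case `μ = 0` is carried along by `sinhDiv`; its additive constant `logConst` is
never evaluated, since it cancels from the bilinear forms. -/

/-! ### Uniqueness of the Whittaker function -/

theorem IsWhittakerW.wronskian_const {κ μ : ℂ} {y₁ y₂ : ℝ → ℂ} (h₁ : IsWhittakerW κ μ y₁)
    (h₂ : IsWhittakerW κ μ y₂) :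
    ∃ C : ℂ, ∀ x : ℝ, 0 < x → y₁ x * deriv y₂ x - deriv y₁ x * y₂ x = C := by
  refine ⟨y₁ 1 * deriv y₂ 1 - deriv y₁ 1 * y₂ 1, fun x hx => ?_⟩
  have hd : ∀ t ∈ Set.Ioi (0 : ℝ), HasDerivWithinAt
      (fun t => y₁ t * deriv y₂ t - deriv y₁ t * y₂ t) 0 (Set.Ioi 0) t := by
    intro t ht
    have e := ((h₁.differentiable t ht).hasDerivAt.mul
      (h₂.differentiable_deriv t ht).hasDerivAt).sub
      ((h₁.differentiable_deriv t ht).hasDerivAt.mul (h₂.differentiable t ht).hasDerivAt)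
    refine (e.congr_deriv ?_).hasDerivWithinAt
    linear_combination y₁ t * h₂.equation t ht - y₂ t * h₁.equation t ht
  have := (convex_Ioi (0 : ℝ)).norm_image_sub_le_of_norm_hasDerivWithin_le (C := 0) hd
    (by simp) (Set.mem_Ioi.2 one_pos) (Set.mem_Ioi.2 hx)
  simpa [sub_eq_zero] using this

theorem tendsto_rpow_mul_exp_atTop (s : ℝ) :
    Tendsto (fun x : ℝ => x ^ s * Real.exp x) atTop atTop := by
  have := tendsto_exp_div_rpow_atTop (-s)
  refine this.congr' ?_
  filter_upwards [eventually_gt_atTop 0] with x hx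
  rw [Real.rpow_neg hx.le, div_inv_eq_mul, mul_comm]

theorem cpow_mul_exp_eq_ofReal (k : ℝ) {x : ℝ} (hx : 0 < x) :
    (x : ℂ) ^ (k : ℂ) * Complex.exp (-(x : ℂ) / 2) = ((x ^ k * Real.exp (-x / 2) : ℝ) : ℂ) := by
  push_cast [Complex.ofReal_cpow hx.le]
  rfl

/-- The quotient `y₂ / y₁` tends to 1 and has derivative `C / y₁²`, where `C` is the Wronskian.
Since `1 / y₁²` grows like `x^{-2k} e^x`, a nonzero `C` would make the quotient unbounded. Reality
of `k` makes the comparison function positive, so real parts can be compared. -/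
theorem IsWhittakerW.eventuallyEq {k : ℝ} {μ : ℂ} {y₁ y₂ : ℝ → ℂ} (h₁ : IsWhittakerW k μ y₁)
    (h₂ : IsWhittakerW k μ y₂) : y₁ =ᶠ[atTop] y₂ := by
  obtain ⟨C, hC⟩ := h₁.wronskian_const h₂
  set g : ℝ → ℂ := fun x : ℝ => (x : ℂ) ^ (k : ℂ) * Complex.exp (-(x : ℂ) / 2) with hg
  have hg0 : ∀ᶠ x in atTop, g x ≠ 0 := by
    filter_upwards [eventually_gt_atTop 0] with x hx
    rw [hg]; simp only
    rw [cpow_mul_exp_eq_ofReal k hx]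
    exact Complex.ofReal_ne_zero.2 (by positivity)
  have hy₁ : ∀ᶠ x in atTop, y₁ x ≠ 0 := by
    have := h₁.asymptotics.symm.isBigO.eq_zero_imp
    filter_upwards [this, hg0] with x hx h0 h
    exact h0 (hx h)
  have hq₁ : Tendsto (fun x => y₁ x / g x) atTop (𝓝 1) :=
    (isEquivalent_iff_tendsto_one hg0).1 h₁.asymptotics
  have hr : Tendsto (fun x => y₂ x / y₁ x) atTop (𝓝 1) :=
    (isEquivalent_iff_tendsto_one hy₁).1 (h₂.asymptotics.trans h₁.asymptotics.symm)
  obtain ⟨T, hT0, hT⟩ : ∃ T : ℝ, 0 < T ∧ ∀ x ≥ T, y₁ x ≠ 0 := by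
    obtain ⟨T, hT⟩ := eventually_atTop.1 hy₁
    exact ⟨max T 1, by positivity, fun x hx => hT x (le_trans (le_max_left _ _) hx)⟩
  have hder : ∀ x ≥ T, HasDerivAt (fun x => y₂ x / y₁ x) (C / y₁ x ^ 2) x := by
    intro x hx
    have hx0 : 0 < x := hT0.trans_le hx
    refine ((h₂.differentiable x hx0).hasDerivAt.div (h₁.differentiable x hx0).hasDerivAt
      (hT x hx)).congr_deriv ?_
    rw [← hC x hx0]; ring
  have hC0 : C = 0 := by
    by_contra hne
    have hinv : ∀ᶠ x in atTop, 1 ≤ ((y₁ x ^ 2)⁻¹).re := by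
      have h1 : Tendsto (fun x => (((y₁ x / g x) ^ 2)⁻¹).re) atTop (𝓝 1) := by
        have := (hq₁.pow 2).inv₀ (by simp)
        have h3 := (Complex.continuous_re.tendsto _).comp this
        rwa [one_pow, inv_one, Complex.one_re] at h3
      have h2 := tendsto_rpow_mul_exp_atTop (-2 * k)
      filter_upwards [h1.eventually (lt_mem_nhds (show (1 / 2 : ℝ) < 1 by norm_num)),
        h2.eventually_ge_atTop 2, eventually_gt_atTop 0] with x hx1 hx2 hx0
      have e : (y₁ x ^ 2)⁻¹ = ((x ^ (-2 * k) * Real.exp x : ℝ) : ℂ) * ((y₁ x / g x) ^ 2)⁻¹ := by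
        have : g x ^ 2 = ((x ^ (-2 * k) * Real.exp x : ℝ) : ℂ)⁻¹ := by
          rw [hg]; simp only
          rw [cpow_mul_exp_eq_ofReal k hx0, ← Complex.ofReal_pow, ← Complex.ofReal_inv, mul_pow,
            mul_inv, ← Real.exp_neg, ← Real.exp_nat_mul, ← Real.rpow_natCast, ← Real.rpow_mul hx0.le,
            ← Real.rpow_neg hx0.le]
          congr 3 <;> push_cast <;> ring
        rw [div_pow, this, div_inv_eq_mul, mul_inv_rev, ← mul_assoc, mul_inv_cancel₀, one_mul]
        exact Complex.ofReal_ne_zero.2 (by positivity)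
      rw [e, Complex.re_ofReal_mul]
      nlinarith
    obtain ⟨T', hT'⟩ := eventually_atTop.1 hinv
    set X := max T T' with hX
    -- Dividing by `C` leaves the derivative `1 / y₁²`, whose real part is at least 1 from `X` on,
    -- so `f` outgrows a line while it should converge to `Re (1 / C)`.
    set f : ℝ → ℝ := fun x => (y₂ x / y₁ x / C).re with hf
    have hfd : ∀ x ≥ X, HasDerivAt f ((y₁ x ^ 2)⁻¹).re x := by
      intro x hx
      have h1 := (hder x ((le_max_left _ _).trans hx)).div_const C
      have h2 := (Complex.reCLM.hasFDerivAt).comp_hasDerivAt x h1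
      have h3 : C / y₁ x ^ 2 / C = (y₁ x ^ 2)⁻¹ := by field_simp
      rw [h3] at h2
      exact h2
    have hlin : ∀ x ≥ X, 1 * (x - X) ≤ f x - f X := by
      intro x hx
      refine (convex_Ici X).mul_sub_le_image_sub_of_le_deriv
        (fun t ht => (hfd t ht).continuousAt.continuousWithinAt)
        (fun t ht => (hfd t (interior_subset ht)).differentiableAt.differentiableWithinAt)
        (fun t ht => ?_) X Set.self_mem_Ici x hx hx
      rw [(hfd t (interior_subset ht)).deriv]
      exact hT' t ((le_max_right _ _).trans (interior_subset ht))
    have hlim : Tendsto f atTop (𝓝 ((1 / C : ℂ)).re) :=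
      (Complex.continuous_re.tendsto _).comp (hr.div_const C)
    have hinf : Tendsto f atTop atTop := by
      refine tendsto_atTop_mono' atTop (f₁ := fun x => x + (f X - X)) ?_
        (tendsto_atTop_add_const_right _ _ tendsto_id)
      filter_upwards [eventually_ge_atTop X] with x hx
      linarith [hlin x hx]
    exact not_tendsto_nhds_of_tendsto_atTop hinf _ hlim
  have hconst : ∀ x ≥ T, y₂ x / y₁ x = y₂ T / y₁ T := by
    intro x hx
    have := (convex_Ici T).norm_image_sub_le_of_norm_hasDerivWithin_le (C := 0)
      (f := fun x => y₂ x / y₁ x) (f' := fun _ => 0)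
      (fun t ht => ((hder t ht).congr_deriv (by simp [hC0])).hasDerivWithinAt)
      (by simp) Set.self_mem_Ici hx
    simpa [sub_eq_zero] using this
  have h1 : y₂ T / y₁ T = 1 := by
    refine tendsto_nhds_unique (tendsto_const_nhds.congr' ?_) hr
    filter_upwards [eventually_ge_atTop T] with x hx
    exact (hconst x hx).symm
  filter_upwards [eventually_ge_atTop T] with x hx
  have := hconst x hx
  rw [h1, div_eq_one_iff_eq (hT x hx)] at this
  exact this.symm

/-- Whittaker's equation and the decay at infinity determine the solution on `(0, ∞)`. -/
theorem IsWhittakerW.eqOn {k : ℝ} {μ : ℂ} {y₁ y₂ : ℝ → ℂ} (h₁ : IsWhittakerW k μ y₁)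
    (h₂ : IsWhittakerW k μ y₂) {x : ℝ} (hx : 0 < x) : y₁ x = y₂ x := by
  have hev := h₁.eventuallyEq h₂
  obtain ⟨T, hT⟩ := eventually_atTop.1 hev
  set X := max T x + 1 with hX
  have hXx : x ≤ X := by rw [hX]; linarith [le_max_right T x]
  have hXT : T < X := by rw [hX]; linarith [le_max_left T x]
  set q : ℝ → ℂ := fun t => 1 / 4 - (k : ℂ) / (t : ℂ) + (μ ^ 2 - 1 / 4) / (t : ℂ) ^ 2 with hq
  have hqc : ContinuousOn q (Set.Icc x X) := by
    have h0 : ∀ t ∈ Set.Icc x X, (t : ℂ) ≠ 0 := fun t ht =>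
      Complex.ofReal_ne_zero.2 (hx.trans_le ht.1).ne'
    have hc : ContinuousOn (fun t : ℝ => (t : ℂ)) (Set.Icc x X) :=
      Complex.continuous_ofReal.continuousOn
    exact (continuousOn_const.sub (continuousOn_const.div hc h0)).add
      (continuousOn_const.div (hc.pow 2) fun t ht => pow_ne_zero 2 (h0 t ht))
  obtain ⟨K, hK⟩ := isCompact_Icc.exists_bound_of_continuousOn hqc
  -- For the sup norm on pairs the field `(u.2, q u.1)` has Lipschitz constant `max ‖q‖ 1`; the 1
  -- accounts for the first component.
  set K' : NNReal := Real.toNNReal (max K 1)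
  have hder : ∀ y : ℝ → ℂ, IsWhittakerW k μ y → ∀ t : ℝ, 0 < t →
      HasDerivAt (fun t => (y t, deriv y t)) (deriv y t, q t * y t) t := by
    intro y hy t ht
    refine (hy.differentiable t ht).hasDerivAt.prodMk
      ((hy.differentiable_deriv t ht).hasDerivAt.congr_deriv ?_)
    linear_combination hy.equation t ht
  -- Uniqueness runs leftwards from `X`: the two solutions agree on a neighbourhood of `X > T`, so
  -- values and derivatives agree there.
  have := ODE_solution_unique_of_mem_Icc_left (a := x) (b := X) (K := K')
    (v := fun t u => (u.2, q t * u.1)) (s := fun _ => Set.univ)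
    (f := fun t => (y₁ t, deriv y₁ t)) (g := fun t => (y₂ t, deriv y₂ t)) ?_
    (fun t ht => (hder y₁ h₁ t (hx.trans_le ht.1)).continuousAt.continuousWithinAt)
    (fun t ht => (hder y₁ h₁ t (hx.trans ht.1)).hasDerivWithinAt) (by simp)
    (fun t ht => (hder y₂ h₂ t (hx.trans_le ht.1)).continuousAt.continuousWithinAt)
    (fun t ht => (hder y₂ h₂ t (hx.trans ht.1)).hasDerivWithinAt) (by simp) ?_
  · exact (Prod.ext_iff.1 (this ⟨le_rfl, hXx⟩)).1
  · intro t ht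
    refine LipschitzOnWith.of_dist_le_mul fun u _ w _ => ?_
    have hK' : (K' : ℝ) = max K 1 := Real.coe_toNNReal _ (by positivity)
    rw [hK', Prod.dist_eq, Prod.dist_eq, dist_eq_norm, dist_eq_norm, ← mul_sub, norm_mul,
      ← dist_eq_norm, ← dist_eq_norm]
    have hm := hK t ⟨ht.1.le, ht.2⟩
    refine max_le ?_ ?_
    · calc dist u.2 w.2 ≤ 1 * max (dist u.1 w.1) (dist u.2 w.2) := by
            rw [one_mul]; exact le_max_right _ _
        _ ≤ _ := by gcongr; exact le_max_right _ _
    · gcongr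
      · exact hm.trans (le_max_left _ _)
      · exact le_max_left _ _
  · have hE : y₁ =ᶠ[𝓝 X] y₂ := by
      filter_upwards [Ioi_mem_nhds hXT] with t ht using hT t (le_of_lt ht)
    simp only [hE.eq_of_nhds, hE.deriv_eq]

/-- An `epsilon` choice is usable only once some solution is known; uniqueness then identifies it
with any solution constructed by hand. -/
theorem whittakerW_eq {k : ℝ} {μ : ℂ} {y : ℝ → ℂ} (hy : IsWhittakerW k μ y) {x : ℝ}
    (hx : 0 < x) : whittakerW k μ x = y x :=
  IsWhittakerW.eqOn (Classical.epsilon_spec (p := IsWhittakerW k μ) ⟨y, hy⟩) hy hx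

/-! ### Laplace integrals: contiguous relations and behaviour at infinity -/

/-- The integrand `t^{p-1} (1+t)^{b-p}` of the confluent hypergeometric integral. -/
def lapKer (p b : ℂ) (t : ℝ) : ℂ := (t : ℂ) ^ (p - 1) * ((1 + t : ℝ) : ℂ) ^ (b - p)

/-- The Laplace transform of a function on `(0, ∞)`. -/
def lap (f : ℝ → ℂ) (x : ℝ) : ℂ := ∫ t in Ioi (0 : ℝ), ((Real.exp (-(x * t)) : ℝ) : ℂ) * f t

theorem continuousOn_lapKer (p b : ℂ) : ContinuousOn (lapKer p b) (Ioi 0) := by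
  intro t ht
  have ht' : (0 : ℝ) < t := ht
  refine ContinuousAt.continuousWithinAt (ContinuousAt.mul ?_ ?_)
  · exact Complex.continuousAt_ofReal_cpow_const _ _ (Or.inr ht'.ne')
  · exact (Complex.continuousAt_ofReal_cpow_const (1 + t) (b - p) (Or.inr (by positivity))).comp
      (f := fun t : ℝ => 1 + t) (by fun_prop)

theorem norm_lapKer (p b : ℂ) {t : ℝ} (ht : 0 < t) :
    ‖lapKer p b t‖ = t ^ (p.re - 1) * (1 + t) ^ (b.re - p.re) := by
  rw [lapKer, norm_mul, Complex.norm_cpow_eq_rpow_re_of_pos ht,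
    Complex.norm_cpow_eq_rpow_re_of_pos (by positivity)]
  simp

theorem norm_lapKer_le {p b : ℂ} (hp : 1 ≤ p.re) {t : ℝ} (ht : 0 < t) :
    ‖lapKer p b t‖ ≤ (1 + t) ^ (b.re - 1) := by
  rw [norm_lapKer p b ht]
  calc t ^ (p.re - 1) * (1 + t) ^ (b.re - p.re)
      ≤ (1 + t) ^ (p.re - 1) * (1 + t) ^ (b.re - p.re) := by
        gcongr
        linarith
    _ = _ := by rw [← Real.rpow_add (by positivity)]; congr 1; ring

theorem norm_lapKer_le_one {p b : ℂ} (hp : 1 ≤ p.re) (hb : b.re ≤ 1) {t : ℝ} (ht : 0 < t) :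
    ‖lapKer p b t‖ ≤ 1 :=
  (norm_lapKer_le hp ht).trans (Real.rpow_le_one_of_one_le_of_nonpos (by linarith) (by linarith))

theorem norm_lapKer_le_add {p b : ℂ} (hp : 1 ≤ p.re) (hb : b.re ≤ 2) {t : ℝ} (ht : 0 < t) :
    ‖lapKer p b t‖ ≤ 1 + t :=
  (norm_lapKer_le hp ht).trans
    ((Real.rpow_le_rpow_of_exponent_le (by linarith) (by linarith)).trans_eq (Real.rpow_one _))

/-- Differentiating a Laplace transform brings down `-t`; this identity turns that factor into a
shift of both indices. -/
theorem lapKer_succ_succ (p b : ℂ) {t : ℝ} (ht : 0 < t) :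
    lapKer (p + 1) (b + 1) t = t * lapKer p b t := by
  have h0 : (t : ℂ) ≠ 0 := Complex.ofReal_ne_zero.2 ht.ne'
  rw [lapKer, lapKer, show p + 1 - 1 = (p - 1) + 1 by ring, Complex.cpow_add _ _ h0,
    Complex.cpow_one, show b + 1 - (p + 1) = b - p by ring]
  ring

theorem lapKer_add_one (p b : ℂ) {t : ℝ} (ht : 0 < t) :
    lapKer p (b + 1) t = lapKer p b t + lapKer (p + 1) (b + 1) t := by
  have h0 : ((1 + t : ℝ) : ℂ) ≠ 0 := Complex.ofReal_ne_zero.2 (by positivity)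
  rw [lapKer_succ_succ p b ht, lapKer, lapKer, show b + 1 - p = (b - p) + 1 by ring,
    Complex.cpow_add _ _ h0, Complex.cpow_one]
  push_cast
  ring

theorem integrableOn_add_mul_exp {x : ℝ} (hx : 0 < x) :
    IntegrableOn (fun t : ℝ => Real.exp (-(x * t)) * (1 + t)) (Ioi 0) := by
  have h0 := integrableOn_rpow_mul_exp_neg_mul_rpow (p := 1) (s := 0) (b := x) (by norm_num)
    one_pos hx
  have h1 := integrableOn_rpow_mul_exp_neg_mul_rpow (p := 1) (s := 1) (b := x) (by norm_num)
    one_pos hx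
  refine (h0.add h1).congr_fun (fun t _ => ?_) measurableSet_Ioi
  simp only [Pi.add_apply, Real.rpow_zero, Real.rpow_one, neg_mul]
  ring

theorem continuousOn_exp_mul {f : ℝ → ℂ} (hf : ContinuousOn f (Ioi 0)) (x : ℝ) :
    ContinuousOn (fun t => ((Real.exp (-(x * t)) : ℝ) : ℂ) * f t) (Ioi 0) :=
  (by fun_prop : Continuous fun t : ℝ => ((Real.exp (-(x * t)) : ℝ) : ℂ)).continuousOn.mul hf

theorem integrableOn_lap {f : ℝ → ℂ} (hf : ContinuousOn f (Ioi 0))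
    (hb : ∀ t, 0 < t → ‖f t‖ ≤ 1 + t) {x : ℝ} (hx : 0 < x) :
    IntegrableOn (fun t => ((Real.exp (-(x * t)) : ℝ) : ℂ) * f t) (Ioi 0) := by
  refine Integrable.mono' (integrableOn_add_mul_exp hx)
    ((continuousOn_exp_mul hf x).aestronglyMeasurable measurableSet_Ioi) ?_
  refine (ae_restrict_iff' measurableSet_Ioi).2 (ae_of_all _ fun t ht => ?_)
  rw [norm_mul, Complex.norm_real, Real.norm_eq_abs, Real.abs_exp]
  gcongr
  exact hb t ht

theorem hasDerivAt_lap {f : ℝ → ℂ} (hf : ContinuousOn f (Ioi 0))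
    (hb : ∀ t, 0 < t → ‖f t‖ ≤ 1) {x : ℝ} (hx : 0 < x) :
    HasDerivAt (lap f) (-lap (fun t => t * f t) x) x := by
  have hb' : ∀ t, 0 < t → ‖f t‖ ≤ 1 + t := fun t ht => (hb t ht).trans (by linarith)
  have hg : ContinuousOn (fun t : ℝ => -(t : ℂ) * f t) (Ioi 0) :=
    (by fun_prop : Continuous fun t : ℝ => -(t : ℂ)).continuousOn.mul hf
  -- Restricting to `y > x / 2` gives one integrable majorant for all nearby parameters.
  have := (hasDerivAt_integral_of_dominated_loc_of_deriv_le (μ := volume.restrict (Ioi (0 : ℝ)))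
    (F := fun x t => ((Real.exp (-(x * t)) : ℝ) : ℂ) * f t)
    (F' := fun x t => ((Real.exp (-(x * t)) : ℝ) : ℂ) * (-(t : ℂ) * f t))
    (bound := fun t => Real.exp (-(x / 2 * t)) * (1 + t))
    (x₀ := x) (s := Ioi (x / 2)) (Ioi_mem_nhds (by linarith))
    (Eventually.of_forall fun y => (continuousOn_exp_mul hf y).aestronglyMeasurable
      measurableSet_Ioi)
    (integrableOn_lap hf hb' hx)
    ((continuousOn_exp_mul hg x).aestronglyMeasurable measurableSet_Ioi) ?_
    (integrableOn_add_mul_exp (by linarith)) ?_).2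
  · refine this.congr_deriv ?_
    rw [lap, ← integral_neg]
    congr 1
    ext t
    ring
  · refine (ae_restrict_iff' measurableSet_Ioi).2 (ae_of_all _ fun t ht y hy => ?_)
    have ht' : (0 : ℝ) < t := ht
    rw [norm_mul, norm_mul, norm_neg, Complex.norm_real, Complex.norm_real, Real.norm_eq_abs,
      Real.abs_exp, Real.norm_eq_abs, abs_of_pos ht']
    have h1 : x / 2 < y := hy
    have h2 : t * ‖f t‖ ≤ 1 + t := by nlinarith [hb t ht']
    gcongr
  · refine (ae_restrict_iff' measurableSet_Ioi).2 (ae_of_all _ fun t _ y _ => ?_)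
    have h1 : HasDerivAt (fun y : ℝ => Real.exp (-(y * t))) (Real.exp (-(y * t)) * (-t)) y := by
      have := ((hasDerivAt_id y).mul_const t).neg.exp
      simpa using this
    refine (h1.ofReal_comp.mul_const (f t)).congr_deriv ?_
    push_cast
    ring

theorem lap_congr {f g : ℝ → ℂ} (h : ∀ t, 0 < t → f t = g t) (x : ℝ) : lap f x = lap g x :=
  setIntegral_congr_fun measurableSet_Ioi fun t ht => by simp only [h t ht]

theorem hasDerivAt_lap_lapKer {p b : ℂ} (hp : 1 ≤ p.re) (hb : b.re ≤ 1) {x : ℝ} (hx : 0 < x) :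
    HasDerivAt (lap (lapKer p b)) (-lap (lapKer (p + 1) (b + 1)) x) x := by
  rw [lap_congr fun _ ht => lapKer_succ_succ p b ht]
  exact hasDerivAt_lap (continuousOn_lapKer p b) (fun t ht => norm_lapKer_le_one hp hb ht) hx

theorem integrableOn_lap_lapKer {p b : ℂ} (hp : 1 ≤ p.re) (hb : b.re ≤ 2) {x : ℝ} (hx : 0 < x) :
    IntegrableOn (fun t => ((Real.exp (-(x * t)) : ℝ) : ℂ) * lapKer p b t) (Ioi 0) :=
  integrableOn_lap (continuousOn_lapKer p b) (fun _ ht => norm_lapKer_le_add hp hb ht) hx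

theorem lap_lapKer_add_one {p b : ℂ} (hp : 1 ≤ p.re) (hb : b.re ≤ 1) {x : ℝ} (hx : 0 < x) :
    lap (lapKer p (b + 1)) x = lap (lapKer p b) x + lap (lapKer (p + 1) (b + 1)) x := by
  rw [lap_congr fun t ht => lapKer_add_one p b ht]
  simp only [lap, mul_add]
  refine integral_add (integrableOn_lap_lapKer hp (by linarith) hx)
    (integrableOn_lap_lapKer ?_ ?_ hx)
  · simp only [Complex.add_re, Complex.one_re]; linarith
  · simp only [Complex.add_re, Complex.one_re]; linarith

theorem hasDerivAt_ofReal_cpow (c : ℂ) {t : ℝ} (ht : 0 < t) :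
    HasDerivAt (fun t : ℝ => (t : ℂ) ^ c) (c * (t : ℂ) ^ (c - 1)) t := by
  have h := (HasDerivAt.cpow_const (c := c) (hasDerivAt_id (t : ℂ))
    (by simpa using ht)).comp_ofReal
  simpa using h

theorem hasDerivAt_one_add_cpow (c : ℂ) {t : ℝ} (ht : 0 < t) :
    HasDerivAt (fun t : ℝ => ((1 + t : ℝ) : ℂ) ^ c) (c * ((1 + t : ℝ) : ℂ) ^ (c - 1)) t := by
  have h := (hasDerivAt_ofReal_cpow c (t := 1 + t) (by positivity)).scomp t
    ((hasDerivAt_id t).const_add 1)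
  simpa [Function.comp_def] using h

theorem tendsto_exp_mul_one_add {x : ℝ} (hx : 0 < x) :
    Tendsto (fun t : ℝ => Real.exp (-(x * t)) * (1 + t)) atTop (𝓝 0) := by
  have h0 := tendsto_rpow_mul_exp_neg_mul_atTop_nhds_zero 0 x hx
  have h1 := tendsto_rpow_mul_exp_neg_mul_atTop_nhds_zero 1 x hx
  have := h0.add h1
  rw [add_zero] at this
  refine this.congr fun t => ?_
  simp only [Real.rpow_zero, Real.rpow_one, neg_mul]
  ring

/-- Integration by parts of `e^{-xt} t^p (1+t)^{b-p}`. The boundary term at 0 vanishes because `Re p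
> 0`, the one at infinity because of the exponential. -/
theorem mul_lap_lapKer {p b : ℂ} (hp : 1 ≤ p.re) (hb : b.re ≤ 1) {x : ℝ} (hx : 0 < x) :
    x * lap (lapKer (p + 1) (b + 1)) x
      = p * lap (lapKer p b) x + (b - p) * lap (lapKer (p + 1) b) x := by
  have hp1 : 1 ≤ (p + 1).re := by simp only [Complex.add_re, Complex.one_re]; linarith
  have hb1 : (b + 1).re ≤ 2 := by simp only [Complex.add_re, Complex.one_re]; linarith
  set e : ℝ → ℂ := fun t => ((Real.exp (-(x * t)) : ℝ) : ℂ) with he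
  have i1 := (integrableOn_lap_lapKer hp1 hb1 hx).const_mul (x : ℂ)
  have i2 := (integrableOn_lap_lapKer (b := b) hp (by linarith) hx).const_mul p
  have i3 := (integrableOn_lap_lapKer (b := b) hp1 (by linarith) hx).const_mul (b - p)
  have key := integral_Ioi_of_hasDerivAt_of_tendsto (a := 0) (m := 0)
    (f := fun t => e t * lapKer (p + 1) (b + 1) t)
    (f' := fun t => -((x : ℂ) * (e t * lapKer (p + 1) (b + 1) t))
      + (p * (e t * lapKer p b t) + (b - p) * (e t * lapKer (p + 1) b t))) ?_ ?_
      (i1.neg.add (i2.add i3)) ?_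
  · replace key := (integral_add i1.neg (i2.add i3)).symm.trans key
    simp only [Pi.neg_apply, Pi.add_apply] at key
    rw [integral_neg, integral_add i2 i3, integral_const_mul, integral_const_mul,
      integral_const_mul] at key
    have h0 : lapKer (p + 1) (b + 1) 0 = 0 := by
      have : p ≠ 0 := by rintro rfl; norm_num at hp
      simp [lapKer, this]
    rw [h0] at key
    change -((x : ℂ) * lap (lapKer (p + 1) (b + 1)) x) + (p * lap (lapKer p b) x
      + (b - p) * lap (lapKer (p + 1) b) x) = _ at key
    linear_combination -key
  · refine ContinuousAt.continuousWithinAt (ContinuousAt.mul (by fun_prop)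
      (ContinuousAt.mul ?_ ?_))
    · refine Complex.continuousAt_ofReal_cpow_const _ _ (Or.inl ?_)
      simp; linarith
    · exact (Complex.continuousAt_ofReal_cpow_const (1 + 0) _ (Or.inr (by norm_num))).comp
        (f := fun t : ℝ => 1 + t) (by fun_prop)
  · intro t ht
    have ht' : (0 : ℝ) < t := ht
    have h1 : HasDerivAt e (e t * (-x)) t := by
      have := ((hasDerivAt_id t).const_mul x).neg.exp.ofReal_comp
      simpa [he, mul_comm] using this
    have h2 := (hasDerivAt_ofReal_cpow p ht').mul (hasDerivAt_one_add_cpow (b - p) ht')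
    have h3 : HasDerivAt (lapKer (p + 1) (b + 1))
        (p * lapKer p b t + (b - p) * lapKer (p + 1) b t) t := by
      have : lapKer (p + 1) (b + 1) = fun t : ℝ => (t : ℂ) ^ p * ((1 + t : ℝ) : ℂ) ^ (b - p) := by
        funext t
        rw [lapKer, show p + 1 - 1 = p by ring, show b + 1 - (p + 1) = b - p by ring]
      rw [this]
      refine h2.congr_deriv ?_
      rw [lapKer, lapKer, show p + 1 - 1 = p by ring, show b - (p + 1) = b - p - 1 by ring]
      ring
    refine (h1.mul h3).congr_deriv ?_
    ring
  · refine squeeze_zero_norm' ?_ (tendsto_exp_mul_one_add hx)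
    filter_upwards [eventually_gt_atTop 0] with t ht
    rw [norm_mul, Complex.norm_real, Real.norm_eq_abs, Real.abs_exp]
    gcongr
    exact norm_lapKer_le_add hp1 hb1 ht

/-- The leading behaviour at infinity, by dominated convergence after rescaling. -/
theorem tendsto_cpow_mul_lap_lapKer {p b : ℂ} (hp : 1 ≤ p.re) (hb : b.re ≤ 1) :
    Tendsto (fun x : ℝ => (x : ℂ) ^ p * lap (lapKer p b) x) atTop (𝓝 (Complex.Gamma p)) := by
  rw [Complex.Gamma_eq_integral (by linarith), Complex.GammaIntegral]
  have hlim : Tendsto (fun x : ℝ => ∫ s in Ioi (0 : ℝ), ((Real.exp (-s) : ℝ) : ℂ) * (s : ℂ) ^ (p - 1)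
      * ((1 + s / x : ℝ) : ℂ) ^ (b - p)) atTop
      (𝓝 (∫ s in Ioi (0 : ℝ), ((Real.exp (-s) : ℝ) : ℂ) * (s : ℂ) ^ (p - 1))) := by
    refine tendsto_integral_filter_of_dominated_convergence
      (fun s => Real.exp (-s) * s ^ (p.re - 1)) ?_ ?_
      (Real.GammaIntegral_convergent (by linarith)) ?_
    · filter_upwards [eventually_gt_atTop 0] with x hx
      refine ContinuousOn.aestronglyMeasurable (fun s hs => ?_) measurableSet_Ioi
      have hs' : (0 : ℝ) < s := hs
      refine ContinuousAt.continuousWithinAt (ContinuousAt.mul (ContinuousAt.mul (by fun_prop) ?_) ?_)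
      · exact Complex.continuousAt_ofReal_cpow_const _ _ (Or.inr hs'.ne')
      · exact (Complex.continuousAt_ofReal_cpow_const (1 + s / x) (b - p)
          (Or.inr (by positivity))).comp (f := fun s : ℝ => 1 + s / x) (by fun_prop)
    · filter_upwards [eventually_gt_atTop 0] with x hx
      refine (ae_restrict_iff' measurableSet_Ioi).2 (ae_of_all _ fun s hs => ?_)
      have hs' : (0 : ℝ) < s := hs
      rw [norm_mul, norm_mul, Complex.norm_real, Real.norm_eq_abs, Real.abs_exp,
        Complex.norm_cpow_eq_rpow_re_of_pos hs',
        Complex.norm_cpow_eq_rpow_re_of_pos (by positivity), Complex.sub_re, Complex.one_re]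
      -- The last factor is at most 1, since its exponent has real part `Re b - Re p ≤ 0`.
      refine mul_le_of_le_one_right (by positivity) (Real.rpow_le_one_of_one_le_of_nonpos ?_ ?_)
      · have : 0 < s / x := by positivity
        linarith
      · rw [Complex.sub_re]; linarith
    · refine ae_of_all _ fun s => ?_
      have h1 : Tendsto (fun x : ℝ => 1 + s / x) atTop (𝓝 1) := by
        simpa using (tendsto_const_nhds.div_atTop tendsto_id : Tendsto (fun x : ℝ => s / x) _
          (𝓝 0)).const_add 1
      have h2 := (Complex.continuousAt_ofReal_cpow_const 1 (b - p) (Or.inr one_ne_zero)).tendsto.comp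
        h1
      simpa [Function.comp_def] using h2.const_mul
        (((Real.exp (-s) : ℝ) : ℂ) * (s : ℂ) ^ (p - 1))
  refine hlim.congr' ?_
  filter_upwards [eventually_gt_atTop 0] with x hx
  have hsub := integral_comp_mul_left_Ioi (fun s : ℝ => ((Real.exp (-s) : ℝ) : ℂ)
    * (s : ℂ) ^ (p - 1) * ((1 + s / x : ℝ) : ℂ) ^ (b - p)) 0 hx
  rw [mul_zero] at hsub
  have hx0 : (x : ℂ) ≠ 0 := Complex.ofReal_ne_zero.2 hx.ne'
  have : (∫ s in Ioi (0 : ℝ), ((Real.exp (-s) : ℝ) : ℂ) * (s : ℂ) ^ (p - 1)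
      * ((1 + s / x : ℝ) : ℂ) ^ (b - p)) = x * ∫ s in Ioi (0 : ℝ),
      ((Real.exp (-(x * s)) : ℝ) : ℂ) * ((x * s : ℝ) : ℂ) ^ (p - 1)
      * ((1 + x * s / x : ℝ) : ℂ) ^ (b - p) := by
    rw [hsub, Complex.real_smul, Complex.ofReal_inv, mul_inv_cancel_left₀ hx0]
  rw [this, lap, ← integral_const_mul, ← integral_const_mul]
  refine setIntegral_congr_fun measurableSet_Ioi fun s hs => ?_
  have hs' : (0 : ℝ) < s := hs
  rw [lapKer, mul_div_cancel_left₀ _ hx.ne', Complex.ofReal_mul x s,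
    Complex.mul_cpow_ofReal_nonneg hx.le hs'.le]
  conv_rhs => rw [show p = (p - 1) + 1 by ring, Complex.cpow_add _ _ hx0, Complex.cpow_one]
  simp only [sub_add_cancel]
  ring

/-! ### Laplace integrals: behaviour at zero -/

theorem image_div_one_add_Ioi : (fun t : ℝ => t / (1 + t)) '' Ioi 0 = Ioo 0 1 := by
  ext r
  constructor
  · rintro ⟨t, ht, rfl⟩
    have ht' : (0 : ℝ) < t := ht
    exact ⟨by positivity, by simp only; rw [div_lt_one (by positivity)]; linarith⟩
  · rintro ⟨h0, h1⟩
    have h2 : 0 < 1 - r := by linarith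
    refine ⟨r / (1 - r), div_pos h0 h2, ?_⟩
    simp only
    field_simp
    ring

/-- Euler's beta integral over `(0, ∞)`. -/
theorem integral_lapKer {u v : ℂ} : ∫ t in Ioi (0 : ℝ), lapKer u (-v) t
    = Complex.betaIntegral u v := by
  rw [Complex.betaIntegral, intervalIntegral.integral_of_le zero_le_one,
    integral_Ioc_eq_integral_Ioo, ← image_div_one_add_Ioi]
  rw [integral_image_eq_integral_abs_deriv_smul (f := fun t : ℝ => t / (1 + t))
    (f' := fun t => 1 / (1 + t) ^ 2) measurableSet_Ioi]
  · refine setIntegral_congr_fun measurableSet_Ioi fun t ht => ?_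
    have ht' : (0 : ℝ) < t := ht
    have h1 : (0 : ℝ) < 1 + t := by linarith
    have h0 : ((1 + t : ℝ) : ℂ) ≠ 0 := Complex.ofReal_ne_zero.2 h1.ne'
    have e1 : (1 : ℂ) - ((t / (1 + t) : ℝ) : ℂ) = (((1 + t)⁻¹ : ℝ) : ℂ) := by
      rw [← Complex.ofReal_one, ← Complex.ofReal_sub]
      congr 1
      field_simp
      ring
    have e2 : ∀ c : ℂ, (((1 + t)⁻¹ : ℝ) : ℂ) ^ c = ((1 + t : ℝ) : ℂ) ^ (-c) := by
      intro c
      rw [Complex.ofReal_inv, Complex.cpow_neg, Complex.inv_cpow]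
      rw [Complex.arg_ofReal_of_nonneg h1.le]
      exact Real.pi_pos.ne
    rw [abs_of_pos (by positivity), e1, div_eq_mul_inv t, Complex.ofReal_mul,
      Complex.mul_cpow_ofReal_nonneg ht'.le (by positivity), e2, e2, Complex.real_smul, lapKer]
    have e3 : ((1 / (1 + t) ^ 2 : ℝ) : ℂ) = ((1 + t : ℝ) : ℂ) ^ (-2 : ℂ) := by
      rw [Complex.cpow_neg, show (2 : ℂ) = ((2 : ℕ) : ℂ) by norm_num, Complex.cpow_natCast]
      push_cast
      rw [one_div]
    rw [e3, show -v - u = -2 + (-(u - 1) + -(v - 1)) by ring, Complex.cpow_add _ _ h0,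
      Complex.cpow_add _ _ h0]
    ring
  · intro t ht
    have ht' : (0 : ℝ) < t := ht
    have h1 : (1 + t : ℝ) ≠ 0 := by positivity
    refine (((hasDerivAt_id t).div ((hasDerivAt_id t).const_add 1) h1).congr_deriv
      ?_).hasDerivWithinAt
    simp
  · intro s hs t ht hst
    have hs' : (1 + s : ℝ) ≠ 0 := by have : (0 : ℝ) < s := hs; positivity
    have ht' : (1 + t : ℝ) ≠ 0 := by have : (0 : ℝ) < t := ht; positivity
    simp only at hst
    rw [div_eq_div_iff hs' ht'] at hst
    linarith

/-- The difference of `t^{p-1} (1+t)^{b-p}` and its leading term at infinity. -/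
def lapRem (p b : ℂ) (t : ℝ) : ℂ := lapKer p b t - ((1 + t : ℝ) : ℂ) ^ (b - 1)

theorem norm_one_sub_cpow_le {c : ℂ} (hc : 1 ≤ c.re) {r : ℝ} (h0 : 0 < r) (h1 : r ≤ 1) :
    ‖(r : ℂ) ^ c - 1‖ ≤ ‖c‖ * (1 - r) := by
  have := (convex_Icc r 1).norm_image_sub_le_of_norm_hasDerivWithin_le
    (f := fun t : ℝ => (t : ℂ) ^ c) (f' := fun t => c * (t : ℂ) ^ (c - 1)) (C := ‖c‖)
    (x := 1) (y := r)
    (fun t ht => (hasDerivAt_ofReal_cpow c (h0.trans_le ht.1)).hasDerivWithinAt)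
    (fun t ht => ?_) ⟨h1, le_rfl⟩ ⟨le_rfl, h1⟩
  · simpa [abs_of_nonpos (sub_nonpos.2 h1)] using this
  · rw [norm_mul, Complex.norm_cpow_eq_rpow_re_of_pos (h0.trans_le ht.1)]
    refine mul_le_of_le_one_right (norm_nonneg _)
      (Real.rpow_le_one (h0.trans_le ht.1).le ht.2 ?_)
    simpa using hc

/-- The remainder is `(1+t)^{b-1} (r^{p-1} - 1)` with `r = t/(1+t)`, and `1 - r = 1/(1+t)` gains one
power of `1 + t`. This makes it integrable for `Re b < 1`, where `lapKer p b` itself need not be. -/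
theorem norm_lapRem_le {p b : ℂ} (hp : 2 ≤ p.re) {t : ℝ} (ht : 0 < t) :
    ‖lapRem p b t‖ ≤ ‖p - 1‖ * (1 + t) ^ (b.re - 2) := by
  have h1 : (0 : ℝ) < 1 + t := by linarith
  have h0 : ((1 + t : ℝ) : ℂ) ≠ 0 := Complex.ofReal_ne_zero.2 h1.ne'
  have e : lapRem p b t = ((1 + t : ℝ) : ℂ) ^ (b - 1)
      * (((t / (1 + t) : ℝ) : ℂ) ^ (p - 1) - 1) := by
    rw [lapRem, lapKer, div_eq_mul_inv, Complex.ofReal_mul, Complex.mul_cpow_ofReal_nonneg ht.le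
      (by positivity), Complex.ofReal_inv, Complex.inv_cpow, ← Complex.cpow_neg, mul_sub, mul_one,
      show b - p = (b - 1) + -(p - 1) by ring, Complex.cpow_add _ _ h0]
    · ring
    · rw [Complex.arg_ofReal_of_nonneg h1.le]
      exact Real.pi_pos.ne
  rw [e, norm_mul, Complex.norm_cpow_eq_rpow_re_of_pos h1]
  have h2 := norm_one_sub_cpow_le (c := p - 1) (r := t / (1 + t))
    (by rw [Complex.sub_re, Complex.one_re]; linarith) (by positivity)
    (by rw [div_le_one h1]; linarith)
  calc (1 + t) ^ (b - 1).re * _ ≤ (1 + t) ^ (b - 1).re * (‖p - 1‖ * (1 - t / (1 + t))) := by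
        gcongr
    _ = _ := by
      have e1 : (1 + t) ^ (b.re - 2) = (1 + t) ^ (b.re - 1) * (1 + t)⁻¹ := by
        rw [show b.re - 2 = b.re - 1 - 1 by ring, Real.rpow_sub_one h1.ne', div_eq_mul_inv]
      rw [Complex.sub_re, Complex.one_re, e1,
        show 1 - t / (1 + t) = (1 + t)⁻¹ by field_simp; ring]
      ring

theorem continuousOn_one_add_cpow (c : ℂ) :
    ContinuousOn (fun t : ℝ => ((1 + t : ℝ) : ℂ) ^ c) (Ioi 0) :=
  fun _ ht => (hasDerivAt_one_add_cpow c ht).continuousAt.continuousWithinAt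

theorem continuousOn_lapRem (p b : ℂ) : ContinuousOn (lapRem p b) (Ioi 0) :=
  (continuousOn_lapKer p b).sub (continuousOn_one_add_cpow _)

theorem integrableOn_one_add_rpow {s : ℝ} (hs : s < -1) :
    IntegrableOn (fun t : ℝ => (1 + t) ^ s) (Ioi 0) := by
  have := integrableOn_add_rpow_Ioi_of_lt (c := 0) (m := 1) hs (by norm_num)
  simpa [add_comm] using this

theorem integrableOn_of_le_rpow {f : ℝ → ℂ} (hf : ContinuousOn f (Ioi 0)) {C s : ℝ} (hs : s < -1)
    (h : ∀ t, 0 < t → ‖f t‖ ≤ C * (1 + t) ^ s) : IntegrableOn f (Ioi 0) :=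
  Integrable.mono' ((integrableOn_one_add_rpow hs).const_mul C)
    (hf.aestronglyMeasurable measurableSet_Ioi)
    ((ae_restrict_iff' measurableSet_Ioi).2 (ae_of_all _ h))

theorem integrableOn_lapRem {p b : ℂ} (hp : 2 ≤ p.re) (hb : b.re < 1) :
    IntegrableOn (lapRem p b) (Ioi 0) :=
  integrableOn_of_le_rpow (continuousOn_lapRem p b) (by linarith) fun _ ht => norm_lapRem_le hp ht

/-- The derivative of `lapRem p (b + 1)` is `b * lapRem p b` plus a beta integrand, and its boundary
values are `-1` at 0 and 0 at infinity. The factor `b` is kept on the left so that the formula can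
later be divided by `b` in the limit `b → 0`. -/
theorem mul_integral_lapRem {p b : ℂ} (hp : 2 ≤ p.re) (hb : b.re < 1) :
    b * ∫ t in Ioi (0 : ℝ), lapRem p b t
      = 1 - Complex.Gamma p * Complex.Gamma (1 - b) * (Complex.Gamma (p - b))⁻¹ := by
  have hp1 : 1 ≤ (p - 1).re := by rw [Complex.sub_re, Complex.one_re]; linarith
  have i1 := (integrableOn_lapRem hp hb).const_mul b
  have i2 : IntegrableOn (fun t => (p - 1) * lapKer (p - 1) (b - 1) t) (Ioi 0) := by
    refine Integrable.const_mul (integrableOn_of_le_rpow (continuousOn_lapKer _ _) (C := 1)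
      (s := b.re - 2) (by linarith) fun t ht => ?_) _
    rw [one_mul]
    convert norm_lapKer_le hp1 ht using 2
    rw [Complex.sub_re, Complex.one_re]; ring
  have key := integral_Ioi_of_hasDerivAt_of_tendsto (a := 0) (m := 0)
    (f := lapRem p (b + 1)) (f' := fun t => b * lapRem p b t + (p - 1) * lapKer (p - 1) (b - 1) t)
    ?_ ?_ (i1.add i2) ?_
  · replace key := (integral_add i1 i2).symm.trans key
    have hbeta := integral_lapKer (u := p - 1) (v := 1 - b)
    rw [neg_sub] at hbeta
    rw [integral_const_mul, integral_const_mul, hbeta] at key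
    have h0 : lapRem p (b + 1) 0 = -1 := by
      have : p - 1 ≠ 0 := by intro h; rw [h] at hp1; norm_num at hp1
      simp [lapRem, lapKer, this]
    rw [h0, Complex.betaIntegral_eq_Gamma_mul_div _ _ (by linarith) (by simpa using hb)] at key
    have hG : Complex.Gamma p = (p - 1) * Complex.Gamma (p - 1) := by
      have := Complex.Gamma_add_one (p - 1) (by intro h; rw [h] at hp1; norm_num at hp1)
      rwa [sub_add_cancel] at this
    rw [show p - 1 + (1 - b) = p - b by ring] at key
    rw [hG]
    linear_combination key
  · refine ContinuousAt.continuousWithinAt (ContinuousAt.sub (ContinuousAt.mul ?_ ?_) ?_)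
    · refine Complex.continuousAt_ofReal_cpow_const _ _ (Or.inl ?_)
      linarith
    all_goals
      exact (Complex.continuousAt_ofReal_cpow_const (1 + 0) _ (Or.inr (by norm_num))).comp
        (f := fun t : ℝ => 1 + t) (by fun_prop)
  · intro t ht
    have ht' : (0 : ℝ) < t := ht
    have h2 := ((hasDerivAt_ofReal_cpow (p - 1) ht').mul
      (hasDerivAt_one_add_cpow (b + 1 - p) ht')).sub (hasDerivAt_one_add_cpow (b + 1 - 1) ht')
    refine h2.congr_deriv ?_
    have e := lapKer_add_one (p - 1) (b - 1) ht'
    rw [sub_add_cancel, sub_add_cancel] at e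
    have e1 : lapKer (p - 1) b t
        = (t : ℂ) ^ (p - 1 - 1) * ((1 + t : ℝ) : ℂ) ^ (b + 1 - p) := by
      rw [lapKer, show b - (p - 1) = b + 1 - p by ring]
    have e2 : lapKer p b t = (t : ℂ) ^ (p - 1) * ((1 + t : ℝ) : ℂ) ^ (b + 1 - p - 1) := by
      rw [lapKer, show b + 1 - p - 1 = b - p by ring]
    rw [show b + 1 - 1 = b by ring]
    have e3 : lapRem p b t = lapKer p b t - ((1 + t : ℝ) : ℂ) ^ (b - 1) := rfl
    linear_combination (-(p - 1)) * e1 - (b + 1 - p) * e2 + (p - 1) * e - b * e3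
  · have h3 : Tendsto (fun t : ℝ => ‖p - 1‖ * (1 + t) ^ (b.re - 1)) atTop (𝓝 0) := by
      have h4 := (tendsto_rpow_neg_atTop (y := 1 - b.re) (by linarith)).comp
        (tendsto_atTop_add_const_left atTop (1 : ℝ) tendsto_id)
      have := h4.const_mul ‖p - 1‖
      rw [mul_zero] at this
      refine this.congr fun t => ?_
      simp
    refine squeeze_zero_norm' ?_ h3
    filter_upwards [eventually_gt_atTop 0] with t ht
    convert norm_lapRem_le hp ht using 3
    rw [Complex.add_re, Complex.one_re]; ring

/-- The value at `b = 0` follows by letting `b` tend to `0` from the left. -/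
theorem integral_lapRem_zero {p : ℂ} (hp : 2 ≤ p.re) :
    ∫ t in Ioi (0 : ℝ), lapRem p 0 t = deriv Complex.Gamma 1
      + Complex.Gamma p * deriv (fun s : ℂ => (Complex.Gamma s)⁻¹) p := by
  have hlim : Tendsto (fun s : ℝ => ∫ t in Ioi (0 : ℝ), lapRem p (-(s : ℂ)) t) (𝓝[>] 0)
      (𝓝 (∫ t in Ioi (0 : ℝ), lapRem p 0 t)) := by
    refine tendsto_integral_filter_of_dominated_convergence
      (fun t => ‖p - 1‖ * (1 + t) ^ (-2 : ℝ)) ?_ ?_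
      ((integrableOn_one_add_rpow (by norm_num)).const_mul _) ?_
    · exact Eventually.of_forall fun s =>
        (continuousOn_lapRem _ _).aestronglyMeasurable measurableSet_Ioi
    · filter_upwards [self_mem_nhdsWithin] with s hs
      refine (ae_restrict_iff' measurableSet_Ioi).2 (ae_of_all _ fun t ht => ?_)
      have ht' : (0 : ℝ) < t := ht
      have hs' : (0 : ℝ) < s := hs
      refine (norm_lapRem_le hp ht').trans ?_
      gcongr
      · linarith
      · simp; linarith
    · refine (ae_restrict_iff' measurableSet_Ioi).2 (ae_of_all _ fun t ht => ?_)
      have ht' : (0 : ℝ) < t := ht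
      have h0 : ((1 + t : ℝ) : ℂ) ≠ 0 := Complex.ofReal_ne_zero.2 (by positivity)
      have hc : Continuous fun s : ℝ => lapRem p (-(s : ℂ)) t := by
        unfold lapRem lapKer
        refine Continuous.sub (continuous_const.mul ?_) ?_
        · exact Continuous.const_cpow (by fun_prop) (Or.inl h0)
        · exact Continuous.const_cpow (by fun_prop) (Or.inl h0)
      have := (hc.tendsto 0).mono_left (nhdsWithin_le_nhds (s := Ioi 0))
      simpa using this
  -- For `b = -s` the integral equals `(g s - g 0) / s`, so its limit is the derivative of `g` at 0.
  set g : ℂ → ℂ := fun s => Complex.Gamma p * Complex.Gamma (1 + s) * (Complex.Gamma (p + s))⁻¹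
    with hg
  have hp0 : Complex.Gamma p ≠ 0 := Complex.Gamma_ne_zero_of_re_pos (by linarith)
  have hg0 : g 0 = 1 := by simp [hg, hp0]
  have hgd : HasDerivAt g (deriv Complex.Gamma 1
      + Complex.Gamma p * deriv (fun s : ℂ => (Complex.Gamma s)⁻¹) p) 0 := by
    have d1 : HasDerivAt Complex.Gamma (deriv Complex.Gamma 1) (1 + 0) := by
      rw [add_zero]
      refine (Complex.differentiableAt_Gamma 1 fun m h => ?_).hasDerivAt
      have := congrArg Complex.re h
      simp at this
      linarith [m.cast_nonneg (α := ℝ)]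
    have d2 : HasDerivAt (fun s : ℂ => (Complex.Gamma s)⁻¹)
        (deriv (fun s : ℂ => (Complex.Gamma s)⁻¹) p) (p + 0) := by
      rw [add_zero]
      exact (Complex.differentiable_one_div_Gamma p).hasDerivAt
    have d3 := d1.comp_const_add
    have d4 := d2.comp_const_add
    refine ((d3.const_mul (Complex.Gamma p)).mul d4).congr_deriv ?_
    simp only [add_zero, Complex.Gamma_one]
    field_simp
  refine tendsto_nhds_unique hlim ?_
  have hs := hgd.tendsto_slope
  have hcast : Tendsto (fun s : ℝ => (s : ℂ)) (𝓝[>] 0) (𝓝[≠] 0) := by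
    refine tendsto_nhdsWithin_iff.2 ⟨?_, ?_⟩
    · exact (Complex.continuous_ofReal.tendsto' 0 0 (by simp)).mono_left nhdsWithin_le_nhds
    · filter_upwards [self_mem_nhdsWithin] with s hs
      exact Complex.ofReal_ne_zero.2 (ne_of_gt hs)
  refine (hs.comp hcast).congr' ?_
  filter_upwards [self_mem_nhdsWithin] with s hs
  have hs' : (0 : ℝ) < s := hs
  have hs0 : (s : ℂ) ≠ 0 := Complex.ofReal_ne_zero.2 hs'.ne'
  have := mul_integral_lapRem (p := p) (b := -(s : ℂ)) hp (by simp; linarith)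
  simp only [Function.comp, slope_def_field, sub_zero, hg0]
  rw [div_eq_iff hs0]
  simp only [sub_neg_eq_add] at this
  rw [hg]
  linear_combination this

theorem isBigO_rpow_rpow {r s : ℝ} (h : r ≤ s) :
    (fun x : ℝ => x ^ s) =O[𝓝[>] 0] fun x : ℝ => x ^ r := by
  refine IsBigO.of_bound 1 ?_
  filter_upwards [Ioo_mem_nhdsGT (zero_lt_one (α := ℝ))] with x hx
  rw [one_mul, Real.norm_of_nonneg (Real.rpow_nonneg hx.1.le _),
    Real.norm_of_nonneg (Real.rpow_nonneg hx.1.le _)]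
  exact Real.rpow_le_rpow_of_exponent_ge hx.1 hx.2.le h

theorem isBigO_cpow_rpow (c : ℂ) :
    (fun x : ℝ => (x : ℂ) ^ c) =O[𝓝[>] 0] fun x : ℝ => x ^ c.re := by
  refine IsBigO.of_bound 1 ?_
  filter_upwards [self_mem_nhdsWithin] with x hx
  have hx' : (0 : ℝ) < x := hx
  rw [one_mul, Complex.norm_cpow_eq_rpow_re_of_pos hx', Real.norm_of_nonneg (by positivity)]

theorem isBigO_exp_sub_one (k : ℝ) :
    (fun x : ℝ => ((Real.exp (k * x) : ℝ) : ℂ) - 1) =O[𝓝[>] 0] fun x : ℝ => x := by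
  have h : HasDerivAt (fun x : ℝ => ((Real.exp (k * x) : ℝ) : ℂ)) _ 0 :=
    (((hasDerivAt_id (0 : ℝ)).const_mul k).exp).ofReal_comp
  simpa using h.isBigO_sub.mono nhdsWithin_le_nhds

theorem isBigO_exp (k : ℝ) :
    (fun x : ℝ => ((Real.exp (k * x) : ℝ) : ℂ)) =O[𝓝[>] 0] fun _ : ℝ => (1 : ℝ) := by
  have h : Continuous (fun x : ℝ => ((Real.exp (k * x) : ℝ) : ℂ)) := by fun_prop
  exact ((h.tendsto 0).mono_left nhdsWithin_le_nhds).isBigO_one ℝ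

theorem isBigO_mul_rpow {f g : ℝ → ℂ} {r s q : ℝ} (hf : f =O[𝓝[>] 0] fun x : ℝ => x ^ r)
    (hg : g =O[𝓝[>] 0] fun x : ℝ => x ^ s) (hq : q ≤ r + s) :
    (fun x => f x * g x) =O[𝓝[>] 0] fun x : ℝ => x ^ q := by
  refine ((hf.mul hg).congr' EventuallyEq.rfl ?_).trans (isBigO_rpow_rpow hq)
  filter_upwards [self_mem_nhdsWithin] with x hx
  exact (Real.rpow_add hx _ _).symm

theorem lap_lapKer_eq {p b : ℂ} (hp : 2 ≤ p.re) (hb : b.re < 1) {x : ℝ} (hx : 0 < x) :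
    lap (lapKer p b) x
      = lap (lapRem p b) x + lap (fun t : ℝ => ((1 + t : ℝ) : ℂ) ^ (b - 1)) x := by
  have hb1 : ∀ t : ℝ, 0 < t → ‖((1 + t : ℝ) : ℂ) ^ (b - 1)‖ ≤ 1 + t := by
    intro t ht
    rw [Complex.norm_cpow_eq_rpow_re_of_pos (by linarith), Complex.sub_re, Complex.one_re]
    exact (Real.rpow_le_one_of_one_le_of_nonpos (by linarith) (by linarith)).trans (by linarith)
  have i2 := integrableOn_lap (continuousOn_one_add_cpow (b - 1)) hb1 hx
  have i1 := (integrableOn_lap_lapKer (b := b) (p := p) (by linarith) (by linarith) hx).sub i2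
  have := integral_add i1 i2
  simp only [Pi.sub_apply, sub_add_cancel] at this
  rw [lap, this, lap, lap]
  congr 2
  ext t
  rw [lapRem]
  ring

theorem one_sub_exp_neg_le_rpow {y θ : ℝ} (hy : 0 < y) (h0 : 0 ≤ θ) (h1 : θ ≤ 1) :
    1 - Real.exp (-y) ≤ y ^ θ := by
  rcases le_total y 1 with h | h
  · calc 1 - Real.exp (-y) ≤ y ^ (1 : ℝ) := by
          rw [Real.rpow_one]; linarith [Real.add_one_le_exp (-y)]
      _ ≤ y ^ θ := Real.rpow_le_rpow_of_exponent_ge hy h h1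
  · calc 1 - Real.exp (-y) ≤ 1 := by linarith [Real.exp_pos (-y)]
      _ ≤ y ^ θ := Real.one_le_rpow h h0

/-- Interpolation `1 - e^{-xt} ≤ (xt)^θ` with `θ = (1 - Re b)/2`: the condition `-1 < Re b` gives `θ
< 1`, and `θ < 1 - Re b` keeps the majorant `(1+t)^{θ + Re b - 2}` integrable. -/
theorem lap_lapRem_sub_isBigO {p b : ℂ} (hp : 2 ≤ p.re) (hb : b.re < 1) (hb' : -1 < b.re) :
    (fun x => lap (lapRem p b) x - ∫ t in Ioi (0 : ℝ), lapRem p b t)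
      =O[𝓝[>] 0] fun x : ℝ => x ^ ((1 - b.re) / 2) := by
  set θ : ℝ := (1 - b.re) / 2 with hθ
  refine IsBigO.of_bound (∫ t in Ioi (0 : ℝ), ‖p - 1‖ * (1 + t) ^ (θ + (b.re - 2))) ?_
  filter_upwards [self_mem_nhdsWithin] with x hx
  have hx' : (0 : ℝ) < x := hx
  have i2 := integrableOn_lapRem hp hb
  have i1 : IntegrableOn (fun t => ((Real.exp (-(x * t)) : ℝ) : ℂ) * lapRem p b t) (Ioi 0) := by
    refine Integrable.mono' i2.norm
      ((continuousOn_exp_mul (continuousOn_lapRem p b) x).aestronglyMeasurable measurableSet_Ioi)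
      ((ae_restrict_iff' measurableSet_Ioi).2 (ae_of_all _ fun t ht => ?_))
    have ht' : (0 : ℝ) < t := ht
    rw [norm_mul, Complex.norm_real, Real.norm_eq_abs, Real.abs_exp]
    refine mul_le_of_le_one_left (norm_nonneg _) (Real.exp_le_one_iff.2 ?_)
    have := mul_pos hx' ht'
    linarith
  rw [lap, ← integral_sub i1 i2, Real.norm_of_nonneg (by positivity), ← integral_mul_const]
  refine norm_integral_le_of_norm_le
    (((integrableOn_one_add_rpow (by rw [hθ]; linarith)).const_mul _).mul_const _)
    ((ae_restrict_iff' measurableSet_Ioi).2 (ae_of_all _ fun t ht => ?_))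
  have ht' : (0 : ℝ) < t := ht
  have hxt := mul_pos hx' ht'
  rw [show ((Real.exp (-(x * t)) : ℝ) : ℂ) * lapRem p b t - lapRem p b t
    = ((Real.exp (-(x * t)) - 1 : ℝ) : ℂ) * lapRem p b t by push_cast; ring, norm_mul,
    Complex.norm_real, Real.norm_eq_abs, abs_of_nonpos (by
      have := Real.exp_le_one_iff.2 (neg_nonpos.2 hxt.le); linarith), neg_sub]
  have h1 := one_sub_exp_neg_le_rpow hxt (θ := θ) (by rw [hθ]; linarith) (by rw [hθ]; linarith)
  have h2 : (x * t) ^ θ ≤ x ^ θ * (1 + t) ^ θ := by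
    rw [Real.mul_rpow hx'.le ht'.le]
    gcongr
    linarith
  calc _ ≤ (x ^ θ * (1 + t) ^ θ) * (‖p - 1‖ * (1 + t) ^ (b.re - 2)) :=
        mul_le_mul (h1.trans h2) (norm_lapRem_le hp ht') (norm_nonneg _) (by positivity)
    _ = _ := by rw [Real.rpow_add (by linarith)]; ring

/-- Integration by parts raises the exponent from `b - 1` to `b`. When `Re b > -1` the power is
integrable at its singularity, and a Gamma integral becomes available after a shift. -/
theorem mul_lap_one_add_cpow {b : ℂ} (hb : b.re < 1) {x : ℝ} (hx : 0 < x) :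
    b * lap (fun t : ℝ => ((1 + t : ℝ) : ℂ) ^ (b - 1)) x
      = -1 + x * lap (fun t : ℝ => ((1 + t : ℝ) : ℂ) ^ b) x := by
  have bd : ∀ c : ℂ, c.re ≤ 1 → ∀ t : ℝ, 0 < t → ‖((1 + t : ℝ) : ℂ) ^ c‖ ≤ 1 + t := by
    intro c hc t ht
    rw [Complex.norm_cpow_eq_rpow_re_of_pos (by linarith)]
    exact (Real.rpow_le_rpow_of_exponent_le (by linarith) hc).trans_eq (Real.rpow_one _)
  have i1 := (integrableOn_lap (continuousOn_one_add_cpow (b - 1)) (bd (b - 1)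
    (by rw [Complex.sub_re, Complex.one_re]; linarith)) hx).const_mul b
  have i2 := (integrableOn_lap (continuousOn_one_add_cpow b) (bd b hb.le) hx).const_mul (x : ℂ)
  have key := integral_Ioi_of_hasDerivAt_of_tendsto (a := 0) (m := 0)
    (f := fun t : ℝ => ((Real.exp (-(x * t)) : ℝ) : ℂ) * ((1 + t : ℝ) : ℂ) ^ b) ?_ ?_
    (i1.sub i2) ?_
  · replace key := (integral_sub i1 i2).symm.trans key
    rw [integral_const_mul, integral_const_mul] at key
    change b * lap _ x - x * lap _ x = _ at key
    simp only [mul_zero, neg_zero, Real.exp_zero, Complex.ofReal_one, add_zero, Complex.one_cpow,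
      mul_one] at key
    linear_combination key
  · exact ContinuousAt.continuousWithinAt (ContinuousAt.mul (by fun_prop)
      ((Complex.continuousAt_ofReal_cpow_const (1 + 0) _ (Or.inr (by norm_num))).comp
        (f := fun t : ℝ => 1 + t) (by fun_prop)))
  · intro t ht
    have h1 : HasDerivAt (fun t => ((Real.exp (-(x * t)) : ℝ) : ℂ))
        (((Real.exp (-(x * t)) : ℝ) : ℂ) * (-x)) t := by
      have := ((hasDerivAt_id t).const_mul x).neg.exp.ofReal_comp
      simpa [mul_comm] using this
    refine (h1.mul (hasDerivAt_one_add_cpow b ht)).congr_deriv ?_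
    simp only [Pi.sub_apply]
    ring
  · refine squeeze_zero_norm' ?_ (tendsto_exp_mul_one_add hx)
    filter_upwards [eventually_gt_atTop 0] with t ht
    rw [norm_mul, Complex.norm_real, Real.norm_eq_abs, Real.abs_exp]
    gcongr
    exact bd b hb.le t ht

/-- The substitution `s = 1 + t` gives a Gamma integral over `(1, ∞)`, that is the full one minus
the part over `(0, 1]`. That part stays bounded as `x → 0`. -/
theorem lap_one_add_cpow_eq {b : ℂ} (hb' : -1 < b.re) {x : ℝ} (hx : 0 < x) :
    lap (fun t : ℝ => ((1 + t : ℝ) : ℂ) ^ b) x = ((Real.exp (1 * x) : ℝ) : ℂ)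
      * (Complex.Gamma (b + 1) * (x : ℂ) ^ (-(b + 1))
        - ∫ s in Ioc (0 : ℝ) 1, ((Real.exp (-(x * s)) : ℝ) : ℂ) * (s : ℂ) ^ b) := by
  have hG := Complex.integral_cpow_mul_exp_neg_mul_Ioi (a := b + 1) (r := x)
    (by rw [Complex.add_re, Complex.one_re]; linarith) hx
  have hsh := integral_image_eq_integral_abs_deriv_smul (s := Ioi (0 : ℝ))
    (f := fun t : ℝ => 1 + t) (f' := fun _ => 1) measurableSet_Ioi
    (fun t _ => ((hasDerivAt_id t).const_add 1).hasDerivWithinAt)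
    (fun _ _ _ _ h => add_left_cancel h)
    (fun s : ℝ => ((Real.exp (-(x * s)) : ℝ) : ℂ) * (s : ℂ) ^ b)
  rw [image_const_add_Ioi, add_zero] at hsh
  have hint : IntegrableOn (fun s : ℝ => ((Real.exp (-(x * s)) : ℝ) : ℂ) * (s : ℂ) ^ b)
      (Ioi 0) := by
    have h1 := integrableOn_rpow_mul_exp_neg_mul_rpow (p := 1) hb' one_pos hx
    refine Integrable.mono' h1 (ContinuousOn.aestronglyMeasurable (continuousOn_exp_mul
      (fun s hs => (hasDerivAt_ofReal_cpow b hs).continuousAt.continuousWithinAt) x)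
      measurableSet_Ioi) ((ae_restrict_iff' measurableSet_Ioi).2 (ae_of_all _ fun s hs => ?_))
    rw [norm_mul, Complex.norm_real, Real.norm_eq_abs, Real.abs_exp,
      Complex.norm_cpow_eq_rpow_re_of_pos hs, Real.rpow_one, neg_mul, mul_comm]
  have hsplit := setIntegral_union (Ioc_disjoint_Ioi_same (a := (0 : ℝ)) (b := 1))
    measurableSet_Ioi (hint.mono_set Ioc_subset_Ioi_self)
    (hint.mono_set (Ioi_subset_Ioi zero_le_one))
  rw [Ioc_union_Ioi_eq_Ioi zero_le_one, hsh] at hsplit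
  have hG' : ∫ s in Ioi (0 : ℝ), ((Real.exp (-(x * s)) : ℝ) : ℂ) * (s : ℂ) ^ b
      = Complex.Gamma (b + 1) * (x : ℂ) ^ (-(b + 1)) := by
    have e : (1 / (x : ℂ)) ^ (b + 1) = (x : ℂ) ^ (-(b + 1)) := by
      rw [one_div, Complex.inv_cpow, Complex.cpow_neg]
      rw [Complex.arg_ofReal_of_nonneg hx.le]
      exact Real.pi_pos.ne
    rw [mul_comm, ← e, ← hG]
    refine setIntegral_congr_fun measurableSet_Ioi fun s _ => ?_
    rw [add_sub_cancel_right, mul_comm]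
    push_cast
    rfl
  rw [← hG', hsplit, add_sub_cancel_left, lap, ← integral_const_mul]
  refine setIntegral_congr_fun measurableSet_Ioi fun t _ => ?_
  simp only [abs_one, one_smul]
  rw [← mul_assoc, ← Complex.ofReal_mul, ← Real.exp_add]
  congr 4
  ring

theorem lap_one_add_cpow_isBigO {b : ℂ} (h0 : b ≠ 0) (hb : b.re < 1) (hb' : -1 < b.re) :
    (fun x : ℝ => lap (fun t : ℝ => ((1 + t : ℝ) : ℂ) ^ (b - 1)) x
      - (-1 / b + Complex.Gamma b * (x : ℂ) ^ (-b)))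
      =O[𝓝[>] 0] fun x : ℝ => x ^ ((1 - b.re) / 2) := by
  set R : ℝ → ℂ := fun x => ∫ s in Ioc (0 : ℝ) 1, ((Real.exp (-(x * s)) : ℝ) : ℂ) * (s : ℂ) ^ b
    with hR
  have hRb : R =O[𝓝[>] 0] fun _ : ℝ => (1 : ℝ) := by
    refine IsBigO.of_bound (∫ s in Ioc (0 : ℝ) 1, s ^ b.re) ?_
    filter_upwards [self_mem_nhdsWithin] with x hx
    have hx' : (0 : ℝ) < x := hx
    rw [norm_one, mul_one]
    refine norm_integral_le_of_norm_le ?_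
      ((ae_restrict_iff' measurableSet_Ioc).2 (ae_of_all _ fun s hs => ?_))
    · exact (intervalIntegrable_iff_integrableOn_Ioc_of_le zero_le_one).1
        (intervalIntegral.intervalIntegrable_rpow' hb')
    · rw [norm_mul, Complex.norm_real, Real.norm_eq_abs, Real.abs_exp,
        Complex.norm_cpow_eq_rpow_re_of_pos hs.1]
      refine mul_le_of_le_one_left (Real.rpow_nonneg hs.1.le _) (Real.exp_le_one_iff.2 ?_)
      have := mul_pos hx' hs.1
      linarith
  have e : ∀ x : ℝ, 0 < x → lap (fun t : ℝ => ((1 + t : ℝ) : ℂ) ^ (b - 1)) x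
      - (-1 / b + Complex.Gamma b * (x : ℂ) ^ (-b))
      = Complex.Gamma b * ((((Real.exp (1 * x) : ℝ) : ℂ) - 1) * (x : ℂ) ^ (-b))
        - b⁻¹ * (x * (((Real.exp (1 * x) : ℝ) : ℂ) * R x)) := by
    intro x hx
    have hx0 : (x : ℂ) ≠ 0 := Complex.ofReal_ne_zero.2 hx.ne'
    have h1 := mul_lap_one_add_cpow hb hx
    rw [lap_one_add_cpow_eq hb' hx, Complex.Gamma_add_one b h0, neg_add, Complex.cpow_add _ _ hx0,
      Complex.cpow_neg_one] at h1
    have h2 : lap (fun t : ℝ => ((1 + t : ℝ) : ℂ) ^ (b - 1)) x = b⁻¹ * (b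
      * lap (fun t : ℝ => ((1 + t : ℝ) : ℂ) ^ (b - 1)) x) := by rw [inv_mul_cancel_left₀ h0]
    rw [h2, h1, hR]
    field_simp
    ring
  have t1 : (fun x : ℝ => (((Real.exp (1 * x) : ℝ) : ℂ) - 1) * (x : ℂ) ^ (-b)) =O[𝓝[>] 0]
      fun x : ℝ => x ^ ((1 - b.re) / 2) := by
    refine isBigO_mul_rpow (r := 1) (by simpa using isBigO_exp_sub_one 1) (isBigO_cpow_rpow (-b)) ?_
    rw [Complex.neg_re]; linarith
  have t2 : (fun x : ℝ => (x : ℂ) * (((Real.exp (1 * x) : ℝ) : ℂ) * R x)) =O[𝓝[>] 0]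
      fun x : ℝ => x ^ ((1 - b.re) / 2) := by
    refine isBigO_mul_rpow (r := 1) (s := 0) (by simpa using isBigO_cpow_rpow 1) ?_ (by linarith)
    simpa using (isBigO_exp 1).mul hRb
  refine ((t1.const_mul_left (Complex.Gamma b)).sub (t2.const_mul_left b⁻¹)).congr' ?_ EventuallyEq.rfl
  filter_upwards [self_mem_nhdsWithin] with x hx
  exact (e x hx).symm

/-- Behaviour at zero for a non-vanishing index. -/
theorem lap_lapKer_isBigO {p b : ℂ} (hp : 2 ≤ p.re) (h0 : b ≠ 0) (hb : b.re < 1)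
    (hb' : -1 < b.re) :
    (fun x : ℝ => lap (lapKer p b) x - (Complex.Gamma p * Complex.Gamma (-b)
      * (Complex.Gamma (p - b))⁻¹ + Complex.Gamma b * (x : ℂ) ^ (-b)))
      =O[𝓝[>] 0] fun x : ℝ => x ^ ((1 - b.re) / 2) := by
  refine ((lap_lapRem_sub_isBigO hp hb hb').add (lap_one_add_cpow_isBigO h0 hb hb')).congr' ?_
    EventuallyEq.rfl
  filter_upwards [self_mem_nhdsWithin] with x hx
  rw [lap_lapKer_eq hp hb hx]
  have h1 := mul_integral_lapRem hp hb
  have h2 := Complex.Gamma_add_one (-b) (neg_ne_zero.2 h0)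
  rw [show 1 - b = -b + 1 by ring, h2] at h1
  -- The `b⁻¹` here cancels the `-1 / b` contributed by the explicit part of the integrand.
  have h3 : ∫ t in Ioi (0 : ℝ), lapRem p b t = b⁻¹ + Complex.Gamma p * Complex.Gamma (-b)
      * (Complex.Gamma (p - b))⁻¹ := by
    rw [← inv_mul_cancel_left₀ h0 (∫ t in Ioi (0 : ℝ), lapRem p b t), h1]
    field_simp
    ring
  rw [h3]
  ring

theorem isBigO_log_rpow : (fun x : ℝ => ((Real.log x : ℝ) : ℂ)) =O[𝓝[>] 0]
    fun x : ℝ => x ^ (-1 / 2 : ℝ) := by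
  refine (IsBigO.of_norm_left ?_)
  simp only [Complex.norm_real]
  exact (isLittleO_log_rpow_nhdsGT_zero (by norm_num)).isBigO.norm_left

/-- The exponential integral has a logarithmic singularity at zero. -/
theorem exists_lap_inv_isBigO : ∃ C : ℂ,
    (fun x : ℝ => lap (fun t : ℝ => ((1 + t : ℝ) : ℂ) ^ ((0 : ℂ) - 1)) x
      - (C - (Real.log x : ℝ))) =O[𝓝[>] 0] fun x : ℝ => x ^ (1 / 2 : ℝ) := by
  set k : ℝ → ℂ := fun t : ℝ => ((1 + t : ℝ) : ℂ) ^ ((0 : ℂ) - 1) with hk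
  have hk1 : ∀ t, 0 < t → ‖k t‖ ≤ 1 := by
    intro t ht
    simp only [hk]
    rw [Complex.norm_cpow_eq_rpow_re_of_pos (by linarith)]
    exact Real.rpow_le_one_of_one_le_of_nonpos (by linarith) (by norm_num)
  have hkc : ContinuousOn k (Ioi 0) := continuousOn_one_add_cpow _
  -- Since `(1 + t) k(t) = 1`, the transform of `k` satisfies a first order equation with
  -- inhomogeneity `1 / x`.
  have hone : ∀ x : ℝ, 0 < x → lap k x + lap (fun t => t * k t) x = (x : ℂ)⁻¹ := by
    intro x hx
    have i1 := integrableOn_lap hkc (fun t ht => (hk1 t ht).trans (by linarith)) hx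
    have i2 := integrableOn_lap (f := fun t => t * k t)
      ((Complex.continuous_ofReal.continuousOn).mul hkc) (fun t ht => by
        rw [norm_mul, Complex.norm_real, Real.norm_of_nonneg ht.le]
        nlinarith [hk1 t ht]) hx
    rw [lap, lap, ← integral_add i1 i2]
    have : ∫ t in Ioi (0 : ℝ), ((Real.exp (-x * t) : ℝ) : ℂ) = (x : ℂ)⁻¹ := by
      rw [integral_complex_ofReal, integral_exp_mul_Ioi (by linarith)]
      simp
    rw [← this]
    refine setIntegral_congr_fun measurableSet_Ioi fun t ht => ?_
    have ht' : (0 : ℝ) < t := ht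
    have h1 : ((1 + t : ℝ) : ℂ) ≠ 0 := Complex.ofReal_ne_zero.2 (by positivity)
    simp only [hk, zero_sub, Complex.cpow_neg_one]
    field_simp
    push_cast
    ring_nf
  have him : ∀ x, (lap k x).im = 0 := by
    intro x
    have : lap k x = ((∫ t in Ioi (0 : ℝ), Real.exp (-(x * t)) * (1 + t)⁻¹ : ℝ) : ℂ) := by
      rw [← integral_complex_ofReal, lap]
      refine setIntegral_congr_fun measurableSet_Ioi fun t _ => ?_
      simp [hk, Complex.cpow_neg_one]
    rw [this, Complex.ofReal_im]
  -- Multiplying by `e^{-x}` integrates that equation; adding `log x` leaves the derivative `(1 -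
  -- e^{-x})/x`, which lies in `[0, 1]`. Hence `f` is Lipschitz, extends to 0, and the extended
  -- value is the sought constant.
  set f : ℝ → ℝ := fun x => Real.exp (-x) * (lap k x).re + Real.log x with hf
  have hfd : ∀ x ∈ Ioi (0 : ℝ), HasDerivWithinAt f ((1 - Real.exp (-x)) * x⁻¹) (Ioi 0) x := by
    intro x hx
    have hx' : (0 : ℝ) < x := hx
    have d1 : HasDerivAt (fun x => (lap k x).re) ((lap k x).re - x⁻¹) x := by
      have := (Complex.reCLM.hasFDerivAt).comp_hasDerivAt x (hasDerivAt_lap hkc hk1 hx')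
      have e := congrArg Complex.re (hone x hx')
      rw [Complex.add_re, ← Complex.ofReal_inv, Complex.ofReal_re] at e
      refine this.congr_deriv ?_
      simp only [Complex.reCLM_apply, Complex.neg_re]
      linarith
    have d2 : HasDerivAt (fun x : ℝ => Real.exp (-x)) (-Real.exp (-x)) x := by
      simpa using (hasDerivAt_neg x).exp
    refine (((d2.mul d1).add (Real.hasDerivAt_log hx'.ne')).congr_deriv ?_).hasDerivWithinAt
    ring
  have hlip : LipschitzOnWith 1 f (Ioi 0) := by
    refine (convex_Ioi 0).lipschitzOnWith_of_nnnorm_hasDerivWithin_le hfd fun x hx => ?_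
    have hx' : (0 : ℝ) < x := hx
    have h1 : Real.exp (-x) ≤ 1 := Real.exp_le_one_iff.2 (by linarith)
    have h2 : 1 - Real.exp (-x) ≤ x := by linarith [Real.add_one_le_exp (-x)]
    rw [← NNReal.coe_le_coe, coe_nnnorm, Real.norm_of_nonneg
      (mul_nonneg (by linarith) (by positivity)), NNReal.coe_one, ← div_eq_mul_inv,
      div_le_one hx']
    exact h2
  obtain ⟨g, hg, hfg⟩ := hlip.extend_real
  refine ⟨(g 0 : ℂ), ?_⟩
  have hfO : (fun x : ℝ => ((f x - g 0 : ℝ) : ℂ)) =O[𝓝[>] 0] fun x : ℝ => x ^ (1 : ℝ) := by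
    refine IsBigO.of_bound 1 ?_
    filter_upwards [self_mem_nhdsWithin] with x hx
    have := hg.dist_le_mul x 0
    rw [← hfg hx, Real.dist_eq, Real.dist_eq, sub_zero] at this
    simpa [← Complex.ofReal_sub] using this
  have hlogO : (fun x : ℝ => (g 0 : ℂ) - ((Real.log x : ℝ) : ℂ)) =O[𝓝[>] 0]
      fun x : ℝ => x ^ (-1 / 2 : ℝ) := by
    refine IsBigO.sub ?_ isBigO_log_rpow
    have : (fun _ : ℝ => (g 0 : ℂ)) =O[𝓝[>] 0] fun x : ℝ => x ^ (0 : ℝ) := by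
      simpa using isBigO_const_const (g 0 : ℂ) (one_ne_zero (α := ℝ)) (𝓝[>] (0 : ℝ))
    exact this.trans (isBigO_rpow_rpow (by norm_num))
  have hexp : (fun x : ℝ => ((Real.exp (1 * x) : ℝ) : ℂ)) =O[𝓝[>] 0] fun x : ℝ => x ^ (0 : ℝ) := by
    simp only [Real.rpow_zero]
    exact isBigO_exp 1
  have hexp1 : (fun x : ℝ => ((Real.exp (1 * x) : ℝ) : ℂ) - 1) =O[𝓝[>] 0]
      fun x : ℝ => x ^ (1 : ℝ) := by
    simp only [Real.rpow_one]
    exact isBigO_exp_sub_one 1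
  have t1 := isBigO_mul_rpow (q := 1 / 2) hexp hfO (by norm_num)
  have t2 := isBigO_mul_rpow (q := 1 / 2) hexp1 hlogO (by norm_num)
  refine (t1.add t2).congr' ?_ EventuallyEq.rfl
  filter_upwards with x
  have e1 : lap k x = (((lap k x).re : ℝ) : ℂ) := Complex.ext (by simp) (by simp [him x])
  have e2 : Real.exp (1 * x) * Real.exp (-x) = 1 := by
    rw [← Real.exp_add]; simp
  rw [e1]
  have e3 : Real.exp (1 * x) * (f x - g 0) + (Real.exp (1 * x) - 1) * (g 0 - Real.log x)
      = (lap k x).re - (g 0 - Real.log x) := by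
    rw [hf]
    linear_combination ((lap k x).re) * e2
  exact_mod_cast congrArg (fun r : ℝ => (r : ℂ)) e3

/-- Behaviour at zero for the vanishing index, with a constant that does not depend on `p`. -/
theorem exists_lap_lapKer_zero_isBigO : ∃ C : ℂ, ∀ p : ℂ, 2 ≤ p.re →
    (fun x : ℝ => lap (lapKer p 0) x - (Complex.Gamma p
      * deriv (fun s : ℂ => (Complex.Gamma s)⁻¹) p + C - (Real.log x : ℝ)))
      =O[𝓝[>] 0] fun x : ℝ => x ^ (1 / 2 : ℝ) := by
  obtain ⟨C, hC⟩ := exists_lap_inv_isBigO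
  refine ⟨deriv Complex.Gamma 1 + C, fun p hp => ?_⟩
  have h1 := lap_lapRem_sub_isBigO (b := 0) hp (by simp) (by simp)
  simp only [Complex.zero_re, sub_zero] at h1
  refine (h1.add hC).congr' ?_ EventuallyEq.rfl
  filter_upwards [self_mem_nhdsWithin] with x hx
  rw [lap_lapKer_eq hp (by simp) hx, integral_lapRem_zero hp]
  ring

/-! ### Leading coefficients at zero -/

/-- `sinh (μ τ) / μ`, with its limit value `τ` at `μ = 0`. -/
def sinhDiv (μ τ : ℂ) : ℂ := if μ = 0 then τ else Complex.sinh (μ * τ) / μ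

theorem mul_sinhDiv (μ τ : ℂ) : μ * sinhDiv μ τ = Complex.sinh (μ * τ) := by
  rw [sinhDiv]
  split_ifs with h
  · simp [h]
  · field_simp

/-- The reciprocal Gamma function. -/
def rGamma (s : ℂ) : ℂ := (Complex.Gamma s)⁻¹

theorem rGamma_eq (s : ℂ) : rGamma s = s * rGamma (s + 1) :=
  Complex.one_div_Gamma_eq_self_mul_one_div_Gamma_add_one s

theorem differentiable_rGamma : Differentiable ℂ rGamma := Complex.differentiable_one_div_Gamma

theorem deriv_rGamma (s : ℂ) : deriv rGamma s = rGamma (s + 1) + s * deriv rGamma (s + 1) := by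
  have h : HasDerivAt (fun s => s * rGamma (s + 1)) (1 * rGamma (s + 1)
      + s * deriv rGamma (s + 1)) s :=
    (hasDerivAt_id s).mul ((differentiable_rGamma (s + 1)).hasDerivAt.comp_add_const)
  rw [show rGamma = fun s => s * rGamma (s + 1) from funext rGamma_eq, h.deriv, one_mul,
    ← show rGamma = fun s => s * rGamma (s + 1) from funext rGamma_eq]

/-- The coefficient of `cosh (μ log x)` in the behaviour of `x^{-1/2} W_{a+1/2,μ}(x)` at zero. -/
def coefC (μ c a : ℂ) : ℂ :=
  if μ = 0 then deriv rGamma (-a) + c * rGamma (-a)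
  else Complex.Gamma (-(2 * μ)) * rGamma (-μ - a) + Complex.Gamma (2 * μ) * rGamma (μ - a)

/-- The coefficient of `sinh (μ log x) / μ` in the behaviour of `x^{-1/2} W_{a+1/2,μ}(x)` at
zero. -/
def coefS (μ a : ℂ) : ℂ :=
  if μ = 0 then -rGamma (-a)
  else μ * (Complex.Gamma (-(2 * μ)) * rGamma (-μ - a) - Complex.Gamma (2 * μ) * rGamma (μ - a))

/-- The leading part at zero of `x^{-1/2} W_{a+1/2,μ}(x)`. -/
def zeroMain (μ c a : ℂ) (x : ℝ) : ℂ :=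
  coefC μ c a * Complex.cosh (μ * Real.log x) + coefS μ a * sinhDiv μ (Real.log x)

/-- Together with `sub_mul_coefS` this says that `(a² - μ²) zeroMain μ c (a - 1)` equals `x d/dx -
a` applied to `zeroMain μ c a`: the first equation of the system with its `x/2` term dropped. Both
follow from `1/Γ(s) = s/Γ(s+1)`, differentiated once when `μ = 0`. -/
theorem sub_mul_coefC (μ c a : ℂ) :
    (a ^ 2 - μ ^ 2) * coefC μ c (a - 1) = coefS μ a - a * coefC μ c a := by
  rw [coefC, coefS, coefC]
  split_ifs with h
  · subst h
    have h1 := rGamma_eq (-a)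
    have h2 := deriv_rGamma (-a)
    rw [show -(a - 1) = -a + 1 by ring]
    linear_combination (1 + a * c) * h1 + a * h2
  · have h1 := rGamma_eq (-μ - a)
    have h2 := rGamma_eq (μ - a)
    rw [show -μ - (a - 1) = -μ - a + 1 by ring, show μ - (a - 1) = μ - a + 1 by ring]
    linear_combination (-(μ - a) * Complex.Gamma (-(2 * μ))) * h1
      + (μ + a) * Complex.Gamma (2 * μ) * h2

theorem sub_mul_coefS (μ c a : ℂ) :
    (a ^ 2 - μ ^ 2) * coefS μ (a - 1) = μ ^ 2 * coefC μ c a - a * coefS μ a := by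
  rw [coefC, coefS, coefS]
  split_ifs with h
  · subst h
    have h1 := rGamma_eq (-a)
    rw [show -(a - 1) = -a + 1 by ring]
    linear_combination (-a) * h1
  · have h1 := rGamma_eq (-μ - a)
    have h2 := rGamma_eq (μ - a)
    rw [show -μ - (a - 1) = -μ - a + 1 by ring, show μ - (a - 1) = μ - a + 1 by ring]
    linear_combination (-(μ - a) * μ * Complex.Gamma (-(2 * μ))) * h1
      - (μ + a) * μ * Complex.Gamma (2 * μ) * h2

/-- The three-term recurrence is the `x = 0` case of the contiguous relation used in
`WhittakerPair.succ`; with it the expansion at zero passes from `a` to `a + 1` with the same `c`. -/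
theorem coefC_add_one (μ c a : ℂ) : coefC μ c (a + 1)
    = -(2 * a + 1) * coefC μ c a - (a ^ 2 - μ ^ 2) * coefC μ c (a - 1) := by
  rw [sub_mul_coefC, coefC, coefC, coefS]
  split_ifs with h
  · have h1 := rGamma_eq (-(a + 1))
    have h2 := deriv_rGamma (-(a + 1))
    rw [show -(a + 1) + 1 = -a by ring] at h1 h2
    linear_combination c * h1 + h2
  · have h1 := rGamma_eq (-μ - (a + 1))
    have h2 := rGamma_eq (μ - (a + 1))
    rw [show -μ - (a + 1) + 1 = -μ - a by ring] at h1
    rw [show μ - (a + 1) + 1 = μ - a by ring] at h2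
    linear_combination Complex.Gamma (-(2 * μ)) * h1 + Complex.Gamma (2 * μ) * h2

theorem coefS_add_one (μ a : ℂ) : coefS μ (a + 1)
    = -(2 * a + 1) * coefS μ a - (a ^ 2 - μ ^ 2) * coefS μ (a - 1) := by
  rw [sub_mul_coefS μ 0, coefC, coefS, coefS]
  split_ifs with h
  · subst h
    have h1 := rGamma_eq (-(a + 1))
    rw [show -(a + 1) + 1 = -a by ring] at h1
    linear_combination -h1
  · have h1 := rGamma_eq (-μ - (a + 1))
    have h2 := rGamma_eq (μ - (a + 1))
    rw [show -μ - (a + 1) + 1 = -μ - a by ring] at h1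
    rw [show μ - (a + 1) + 1 = μ - a by ring] at h2
    linear_combination μ * Complex.Gamma (-(2 * μ)) * h1 - μ * Complex.Gamma (2 * μ) * h2

theorem cpow_eq_exp_log {x : ℝ} (hx : 0 < x) (μ : ℂ) :
    (x : ℂ) ^ μ = Complex.exp (μ * Real.log x) := by
  rw [Complex.cpow_def_of_ne_zero (Complex.ofReal_ne_zero.2 hx.ne'), ← Complex.ofReal_log hx.le,
    mul_comm]

theorem isLittleO_rpow_rpow {r s : ℝ} (h : r < s) :
    (fun x : ℝ => x ^ s) =o[𝓝[>] 0] fun x : ℝ => x ^ r := by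
  have h0 : Tendsto (fun x : ℝ => x ^ (s - r)) (𝓝[>] 0) (𝓝 0) := by
    have := (Real.continuousAt_rpow_const 0 (s - r) (Or.inr (by linarith))).tendsto
    rw [Real.zero_rpow (by linarith)] at this
    exact this.mono_left nhdsWithin_le_nhds
  have h1 := ((isLittleO_one_iff ℝ).2 h0).mul_isBigO
    (isBigO_refl (fun x : ℝ => x ^ r) (𝓝[>] (0 : ℝ)))
  refine h1.congr' ?_ (Eventually.of_forall fun x => one_mul _)
  filter_upwards [self_mem_nhdsWithin] with x hx
  rw [← Real.rpow_add hx, sub_add_cancel]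

theorem isLittleO_cosh_log {μ : ℂ} (h1 : -1 / 2 < μ.re) (h2 : μ.re < 1 / 2) :
    (fun x : ℝ => Complex.cosh (μ * Real.log x)) =o[𝓝[>] 0] fun x : ℝ => x ^ (-1 / 2 : ℝ) := by
  have e1 := (isBigO_cpow_rpow μ).trans_isLittleO (isLittleO_rpow_rpow (r := -1 / 2) h1)
  have e2 := (isBigO_cpow_rpow (-μ)).trans_isLittleO (isLittleO_rpow_rpow (r := -1 / 2)
    (by rw [Complex.neg_re]; linarith))
  refine ((e1.add e2).const_mul_left (1 / 2)).congr' ?_ EventuallyEq.rfl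
  filter_upwards [self_mem_nhdsWithin] with x hx
  rw [cpow_eq_exp_log hx, cpow_eq_exp_log hx, Complex.cosh, neg_mul]
  ring

theorem isLittleO_sinhDiv_log {μ : ℂ} (h1 : -1 / 2 < μ.re) (h2 : μ.re < 1 / 2) :
    (fun x : ℝ => sinhDiv μ (Real.log x)) =o[𝓝[>] 0] fun x : ℝ => x ^ (-1 / 2 : ℝ) := by
  by_cases h : μ = 0
  · simp only [sinhDiv, if_pos h]
    refine IsLittleO.of_norm_left ?_
    simp only [Complex.norm_real]
    exact (isLittleO_log_rpow_nhdsGT_zero (by norm_num)).norm_left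
  have e1 := (isBigO_cpow_rpow μ).trans_isLittleO (isLittleO_rpow_rpow (r := -1 / 2) h1)
  have e2 := (isBigO_cpow_rpow (-μ)).trans_isLittleO (isLittleO_rpow_rpow (r := -1 / 2)
    (by rw [Complex.neg_re]; linarith))
  refine ((e1.sub e2).const_mul_left (1 / 2 / μ)).congr' ?_ EventuallyEq.rfl
  filter_upwards [self_mem_nhdsWithin] with x hx
  rw [cpow_eq_exp_log hx, cpow_eq_exp_log hx, sinhDiv, if_neg h, Complex.sinh, neg_mul]
  ring

/-- This is where `|Re μ| < 1/2` matters: leading parts are `o(x^{-1/2})`, exactly what errors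
`O(x^{1/2})` can absorb. -/
theorem isLittleO_zeroMain {μ : ℂ} (h1 : -1 / 2 < μ.re) (h2 : μ.re < 1 / 2) (c a : ℂ) :
    zeroMain μ c a =o[𝓝[>] 0] fun x : ℝ => x ^ (-1 / 2 : ℝ) :=
  ((isLittleO_cosh_log h1 h2).const_mul_left _).add
    ((isLittleO_sinhDiv_log h1 h2).const_mul_left _)

/-! ### Contiguous pairs and their existence -/

/-- `(A, B)` is the pair `x^{-1/2} W_{a+1/2,μ}(x)`, `x^{-1/2} W_{a-1/2,μ}(x)`, described by its
first order system and its behaviour at infinity and at zero. -/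
structure WhittakerPair (μ c a : ℂ) (A B : ℝ → ℂ) : Prop where
  hasDerivAt_fst : ∀ x : ℝ, 0 < x →
    HasDerivAt A (((a - x / 2) * A x + (a ^ 2 - μ ^ 2) * B x) / x) x
  hasDerivAt_snd : ∀ x : ℝ, 0 < x → HasDerivAt B (((x / 2 - a) * B x - A x) / x) x
  infty_fst : Tendsto (fun x : ℝ => A x / ((x : ℂ) ^ a * Complex.exp (-(x : ℂ) / 2))) atTop (𝓝 1)
  infty_snd : Tendsto (fun x : ℝ => B x / ((x : ℂ) ^ (a - 1) * Complex.exp (-(x : ℂ) / 2)))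
    atTop (𝓝 1)
  zero_fst : (fun x => A x - zeroMain μ c a x) =O[𝓝[>] 0] fun x : ℝ => x ^ (1 / 2 : ℝ)
  zero_snd : (fun x => B x - zeroMain μ c (a - 1) x) =O[𝓝[>] 0] fun x : ℝ => x ^ (1 / 2 : ℝ)

theorem WhittakerPair.isLittleO_fst {μ c a : ℂ} {A B : ℝ → ℂ} (h : WhittakerPair μ c a A B)
    (h1 : -1 / 2 < μ.re) (h2 : μ.re < 1 / 2) : A =o[𝓝[>] 0] fun x : ℝ => x ^ (-1 / 2 : ℝ) := by
  have := (h.zero_fst.trans_isLittleO (isLittleO_rpow_rpow (r := -1 / 2) (by norm_num))).add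
    (isLittleO_zeroMain h1 h2 c a)
  simpa using this

theorem WhittakerPair.isLittleO_snd {μ c a : ℂ} {A B : ℝ → ℂ} (h : WhittakerPair μ c a A B)
    (h1 : -1 / 2 < μ.re) (h2 : μ.re < 1 / 2) : B =o[𝓝[>] 0] fun x : ℝ => x ^ (-1 / 2 : ℝ) := by
  have := (h.zero_snd.trans_isLittleO (isLittleO_rpow_rpow (r := -1 / 2) (by norm_num))).add
    (isLittleO_zeroMain h1 h2 c (a - 1))
  simpa using this

/-- Raising the first index by one. -/
theorem WhittakerPair.succ {μ c a : ℂ} {A B : ℝ → ℂ} (h : WhittakerPair μ c a A B)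
    (h1 : -1 / 2 < μ.re) (h2 : μ.re < 1 / 2) :
    WhittakerPair μ c (a + 1)
      (fun x => (x - 2 * a - 1) * A x - (a ^ 2 - μ ^ 2) * B x) A where
  hasDerivAt_fst x hx := by
    have hx0 : (x : ℂ) ≠ 0 := Complex.ofReal_ne_zero.2 hx.ne'
    have d1 : HasDerivAt (fun x : ℝ => (x : ℂ) - 2 * a - 1) 1 x := by
      simpa using (((hasDerivAt_id x).ofReal_comp).sub_const (2 * a)).sub_const 1
    refine ((d1.mul (h.hasDerivAt_fst x hx)).sub
      ((h.hasDerivAt_snd x hx).const_mul (a ^ 2 - μ ^ 2))).congr_deriv ?_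
    field_simp
    ring
  hasDerivAt_snd x hx := by
    have hx0 : (x : ℂ) ≠ 0 := Complex.ofReal_ne_zero.2 hx.ne'
    refine (h.hasDerivAt_fst x hx).congr_deriv ?_
    field_simp
    ring
  infty_fst := by
    have hinv : Tendsto (fun x : ℝ => (x : ℂ)⁻¹) atTop (𝓝 0) := by
      have := (Complex.continuous_ofReal.tendsto 0).comp tendsto_inv_atTop_zero
      simpa [Function.comp_def] using this
    have := ((((hinv.const_mul (2 * a + 1)).const_sub 1).mul h.infty_fst)).sub
      (((hinv.pow 2).const_mul (a ^ 2 - μ ^ 2)).mul h.infty_snd)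
    simp only [mul_zero, sub_zero, mul_one, ne_eq, OfNat.ofNat_ne_zero, not_false_eq_true,
      zero_pow] at this
    refine this.congr' ?_
    filter_upwards [eventually_gt_atTop 0] with x hx
    have hx0 : (x : ℂ) ≠ 0 := Complex.ofReal_ne_zero.2 hx.ne'
    have e1 : (x : ℂ) ^ (a + 1) = (x : ℂ) ^ a * x := by rw [Complex.cpow_add _ _ hx0, Complex.cpow_one]
    have e2 : (x : ℂ) ^ (a - 1) = (x : ℂ) ^ a / x := by rw [Complex.cpow_sub _ _ hx0, Complex.cpow_one]
    have e3 : (x : ℂ) ^ a ≠ 0 := by simp [Complex.cpow_eq_zero_iff, hx0]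
    have e4 := Complex.exp_ne_zero (-(x : ℂ) / 2)
    rw [e1, e2]
    field_simp
    ring
  infty_snd := by simpa using h.infty_fst
  zero_fst := by
    have t1 := isBigO_mul_rpow (f := fun x : ℝ => (x : ℂ)) (r := 1) (q := 1 / 2)
      (by simpa using isBigO_cpow_rpow 1) (h.isLittleO_fst h1 h2).isBigO (by norm_num)
    refine (t1.add ((h.zero_fst.const_mul_left (-(2 * a + 1))).sub
      (h.zero_snd.const_mul_left (a ^ 2 - μ ^ 2)))).congr' ?_ EventuallyEq.rfl
    filter_upwards with x
    simp only [zeroMain]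
    rw [coefC_add_one, coefS_add_one]
    ring
  zero_snd := by simpa using h.zero_fst

/-- `x^{-1/2} W_{a+1/2,μ}(x)` as a Laplace integral, for `p = μ - a`. -/
def whittakerBase (μ p : ℂ) (x : ℝ) : ℂ :=
  (x : ℂ) ^ μ * Complex.exp (-(x : ℂ) / 2) * (rGamma p * lap (lapKer p (2 * μ)) x)

theorem hasDerivAt_whittakerBase {μ p : ℂ} (hp : 1 ≤ p.re) (h2 : μ.re < 1 / 2) {x : ℝ}
    (hx : 0 < x) : HasDerivAt (whittakerBase μ p) ((x : ℂ) ^ μ * Complex.exp (-(x : ℂ) / 2)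
      * (rGamma p * ((μ - x / 2) * lap (lapKer p (2 * μ)) x
        - x * lap (lapKer (p + 1) (2 * μ + 1)) x)) / x) x := by
  have hx0 : (x : ℂ) ≠ 0 := Complex.ofReal_ne_zero.2 hx.ne'
  have d1 := hasDerivAt_ofReal_cpow μ hx
  have d2 : HasDerivAt (fun x : ℝ => Complex.exp (-(x : ℂ) / 2))
      (Complex.exp (-(x : ℂ) / 2) * (-1 / 2)) x := by
    simpa using (((hasDerivAt_id x).ofReal_comp.neg).div_const 2).cexp
  have d3 := (hasDerivAt_lap_lapKer (b := 2 * μ) hp (by simp; linarith) hx).const_mul (rGamma p)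
  refine ((d1.mul d2).mul d3).congr_deriv ?_
  simp only [Pi.mul_apply]
  rw [Complex.cpow_sub _ _ hx0, Complex.cpow_one]
  field_simp
  ring

theorem tendsto_whittakerBase {μ p a : ℂ} (hp : 1 ≤ p.re) (h2 : μ.re < 1 / 2) (ha : a = μ - p) :
    Tendsto (fun x : ℝ => whittakerBase μ p x / ((x : ℂ) ^ a * Complex.exp (-(x : ℂ) / 2)))
      atTop (𝓝 1) := by
  have h := (tendsto_cpow_mul_lap_lapKer (b := 2 * μ) hp (by simp; linarith)).const_mul (rGamma p)
  rw [rGamma, inv_mul_cancel₀ (Complex.Gamma_ne_zero_of_re_pos (by linarith))] at h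
  refine h.congr' ?_
  filter_upwards [eventually_gt_atTop 0] with x hx
  have hx0 : (x : ℂ) ≠ 0 := Complex.ofReal_ne_zero.2 hx.ne'
  have e1 : (x : ℂ) ^ μ = (x : ℂ) ^ a * (x : ℂ) ^ p := by
    rw [← Complex.cpow_add _ _ hx0, ha, sub_add_cancel]
  have e3 : (x : ℂ) ^ a ≠ 0 := by simp [Complex.cpow_eq_zero_iff, hx0]
  have e4 := Complex.exp_ne_zero (-(x : ℂ) / 2)
  rw [whittakerBase, e1, rGamma]
  field_simp

/-- The error exponent `(1 - Re b)/2` at `b = 2μ` is matched to the prefactor: `Re μ + (1 - 2 Re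
μ)/2 = 1/2`. Replacing `e^{-x/2}` by 1 costs another `O(x) · O(x^{-1/2})`. -/
theorem whittakerBase_sub_isBigO {μ p : ℂ} {m : ℝ → ℂ}
    (hm : (fun x : ℝ => (x : ℂ) ^ μ * m x) =O[𝓝[>] 0] fun x : ℝ => x ^ (-1 / 2 : ℝ))
    (hl : (fun x : ℝ => lap (lapKer p (2 * μ)) x - m x) =O[𝓝[>] 0]
      fun x : ℝ => x ^ ((1 - (2 * μ).re) / 2)) :
    (fun x : ℝ => whittakerBase μ p x - rGamma p * ((x : ℂ) ^ μ * m x)) =O[𝓝[>] 0]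
      fun x : ℝ => x ^ (1 / 2 : ℝ) := by
  have t0 := isBigO_mul_rpow (q := 1 / 2) (isBigO_cpow_rpow μ) hl (by simp; linarith)
  have t1 := isBigO_mul_rpow (r := 0) (q := 1 / 2) (f := fun x : ℝ =>
    ((Real.exp (-1 / 2 * x) : ℝ) : ℂ))
    (by simp only [Real.rpow_zero]; exact isBigO_exp _) t0 (by norm_num)
  have t2 := isBigO_mul_rpow (r := 1) (q := 1 / 2) (f := fun x : ℝ =>
    ((Real.exp (-1 / 2 * x) : ℝ) : ℂ) - 1)
    (by simp only [Real.rpow_one]; exact isBigO_exp_sub_one _) hm (by norm_num)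
  refine ((t1.add t2).const_mul_left (rGamma p)).congr' ?_ EventuallyEq.rfl
  filter_upwards with x
  rw [whittakerBase, Complex.ofReal_exp, show ((-1 / 2 * x : ℝ) : ℂ) = -(x : ℂ) / 2 by
    push_cast; ring]
  ring

/-- The constant term of the exponential integral at zero (up to normalization). -/
def logConst : ℂ := Classical.choose exists_lap_lapKer_zero_isBigO

theorem lap_lapKer_zero_isBigO {p : ℂ} (hp : 2 ≤ p.re) :
    (fun x : ℝ => lap (lapKer p 0) x - (Complex.Gamma p * deriv rGamma p + logConst
      - (Real.log x : ℝ))) =O[𝓝[>] 0] fun x : ℝ => x ^ (1 / 2 : ℝ) :=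
  Classical.choose_spec exists_lap_lapKer_zero_isBigO p hp

theorem whittakerBase_isBigO {μ p a : ℂ} (hp : 2 ≤ p.re) (h1 : -1 / 2 < μ.re) (h2 : μ.re < 1 / 2)
    (ha : a = μ - p) :
    (fun x : ℝ => whittakerBase μ p x - zeroMain μ logConst a x) =O[𝓝[>] 0]
      fun x : ℝ => x ^ (1 / 2 : ℝ) := by
  have hΓ : rGamma p * Complex.Gamma p = 1 :=
    inv_mul_cancel₀ (Complex.Gamma_ne_zero_of_re_pos (by linarith))
  have hrG : rGamma p ≠ 0 := left_ne_zero_of_mul_eq_one hΓ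
  -- It suffices to exhibit an expansion `m` of the Laplace integral that becomes `zeroMain` after
  -- multiplication by `x^μ / Γ(p)`: logarithmic if `μ = 0`, a constant plus `x^{-2μ}` otherwise.
  have key : ∀ m : ℝ → ℂ, (∀ x : ℝ, 0 < x → rGamma p * ((x : ℂ) ^ μ * m x)
      = zeroMain μ logConst a x) → ((fun x : ℝ => lap (lapKer p (2 * μ)) x - m x) =O[𝓝[>] 0]
      fun x : ℝ => x ^ ((1 - (2 * μ).re) / 2)) →
      (fun x : ℝ => whittakerBase μ p x - zeroMain μ logConst a x) =O[𝓝[>] 0]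
      fun x : ℝ => x ^ (1 / 2 : ℝ) := by
    intro m hm hl
    have hmO : (fun x : ℝ => (x : ℂ) ^ μ * m x) =O[𝓝[>] 0] fun x : ℝ => x ^ (-1 / 2 : ℝ) := by
      refine ((isLittleO_zeroMain h1 h2 logConst a).isBigO.const_mul_left (rGamma p)⁻¹).congr' ?_
        EventuallyEq.rfl
      filter_upwards [self_mem_nhdsWithin] with x hx
      rw [← hm x hx, inv_mul_cancel_left₀ hrG]
    refine (whittakerBase_sub_isBigO hmO hl).congr' ?_ EventuallyEq.rfl
    filter_upwards [self_mem_nhdsWithin] with x hx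
    rw [hm x hx]
  by_cases h : μ = 0
  · subst h
    have hC := lap_lapKer_zero_isBigO hp
    refine key _ (fun x hx => ?_) (by simpa using hC)
    rw [zeroMain, coefC, coefS, if_pos rfl, if_pos rfl, sinhDiv, if_pos rfl, ha]
    simp only [zero_sub, neg_neg, zero_mul, Complex.cosh_zero, Complex.cpow_zero, one_mul, mul_one]
    linear_combination deriv rGamma p * hΓ
  · refine key _ (fun x hx => ?_) (lap_lapKer_isBigO (b := 2 * μ) hp (by simpa using h)
      (by simp; linarith) (by simp; linarith))
    have hx0 : (x : ℂ) ≠ 0 := Complex.ofReal_ne_zero.2 (ne_of_gt hx)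
    rw [zeroMain, coefC, coefS, if_neg h, if_neg h, sinhDiv, if_neg h, ha,
      show -μ - (μ - p) = p - 2 * μ by ring, show μ - (μ - p) = p by ring]
    have e1 : (x : ℂ) ^ μ * (x : ℂ) ^ (-(2 * μ)) = Complex.exp (-(μ * Real.log x)) := by
      rw [← Complex.cpow_add _ _ hx0, cpow_eq_exp_log hx]
      congr 1
      ring
    have e2 := cpow_eq_exp_log hx μ
    rw [Complex.cosh, Complex.sinh, ← e1, ← e2]
    change rGamma p * ((x : ℂ) ^ μ * (Complex.Gamma p * Complex.Gamma (-(2 * μ))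
      * rGamma (p - 2 * μ) + Complex.Gamma (2 * μ) * (x : ℂ) ^ (-(2 * μ)))) = _
    have hμ : μ * μ⁻¹ = 1 := mul_inv_cancel₀ h
    field_simp
    linear_combination 2 * (x : ℂ) ^ μ * Complex.Gamma (-(2 * μ)) * rGamma (p - 2 * μ) * hΓ

/-- Lowering `a` by one raises `p = μ - a` by one at fixed `b = 2μ`. The two equations of the system
are the contiguous relations of the Laplace integrals, with `rGamma_eq` adjusting the normalization.
-/
theorem whittakerPair_base {μ a : ℂ} (hp : 2 ≤ (μ - a).re) (h1 : -1 / 2 < μ.re)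
    (h2 : μ.re < 1 / 2) :
    WhittakerPair μ logConst a (whittakerBase μ (μ - a)) (whittakerBase μ (μ - a + 1)) where
  hasDerivAt_fst x hx := by
    refine (hasDerivAt_whittakerBase (by linarith) h2 hx).congr_deriv ?_
    have k1 := mul_lap_lapKer (p := μ - a) (b := 2 * μ) (by linarith) (by simp; linarith) hx
    have k2 := rGamma_eq (μ - a)
    congr 1
    rw [whittakerBase, whittakerBase]
    linear_combination (-(x : ℂ) ^ μ * Complex.exp (-(x : ℂ) / 2) * rGamma (μ - a)) * k1
      - (x : ℂ) ^ μ * Complex.exp (-(x : ℂ) / 2) * (μ + a)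
        * lap (lapKer (μ - a + 1) (2 * μ)) x * k2
  hasDerivAt_snd x hx := by
    have hp1 : 1 ≤ (μ - a + 1).re := by rw [Complex.add_re, Complex.one_re]; linarith
    refine (hasDerivAt_whittakerBase hp1 h2 hx).congr_deriv ?_
    have k1 := mul_lap_lapKer (p := μ - a) (b := 2 * μ) (by linarith) (by simp; linarith) hx
    have k3 := lap_lapKer_add_one (b := 2 * μ) hp1 (by simp; linarith) hx
    have k2 := rGamma_eq (μ - a)
    congr 1
    rw [whittakerBase, whittakerBase]
    linear_combination ((x : ℂ) ^ μ * Complex.exp (-(x : ℂ) / 2) * rGamma (μ - a + 1))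
      * (x * k3 - k1) - (x : ℂ) ^ μ * Complex.exp (-(x : ℂ) / 2)
        * lap (lapKer (μ - a) (2 * μ)) x * k2 * (-1)
  infty_fst := tendsto_whittakerBase (by linarith) h2 (by ring)
  infty_snd := tendsto_whittakerBase (by rw [Complex.add_re, Complex.one_re]; linarith) h2 (by ring)
  zero_fst := whittakerBase_isBigO hp h1 h2 (by ring)
  zero_snd := whittakerBase_isBigO (by rw [Complex.add_re, Complex.one_re]; linarith) h1 h2
    (by ring)

/-- Any `a` is reached by finitely many unit raises from an index far enough to the left for the
Laplace integral. -/
theorem exists_whittakerPair {μ : ℂ} (h1 : -1 / 2 < μ.re) (h2 : μ.re < 1 / 2) (a : ℂ) :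
    ∃ A B : ℝ → ℂ, WhittakerPair μ logConst a A B := by
  have key : ∀ n : ℕ, ∀ a : ℂ, 2 ≤ (μ - a).re + n → ∃ A B : ℝ → ℂ,
      WhittakerPair μ logConst a A B := by
    intro n
    induction n with
    | zero => exact fun a ha => ⟨_, _, whittakerPair_base (by simpa using ha) h1 h2⟩
    | succ n ih =>
      intro a ha
      obtain ⟨A, B, h⟩ := ih (a - 1) (by
        simp only [Complex.sub_re, Complex.one_re] at ha ⊢
        push_cast at ha
        linarith)
      have := h.succ h1 h2
      rw [sub_add_cancel] at this
      exact ⟨_, _, this⟩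
  obtain ⟨n, hn⟩ := exists_nat_ge (2 - (μ - a).re)
  exact key n a (by linarith)

/-! ### From pairs to Whittaker functions -/

theorem isWhittakerW_of_hasDerivAt {κ μ : ℂ} {y y₁ y₂ : ℝ → ℂ}
    (h₁ : ∀ x : ℝ, 0 < x → HasDerivAt y (y₁ x) x) (h₂ : ∀ x : ℝ, 0 < x → HasDerivAt y₁ (y₂ x) x)
    (heq : ∀ x : ℝ, 0 < x →
      y₂ x - (1 / 4 - κ / (x : ℂ) + (μ ^ 2 - 1 / 4) / (x : ℂ) ^ 2) * y x = 0)
    (has : Tendsto (fun x : ℝ => y x / ((x : ℂ) ^ κ * Complex.exp (-(x : ℂ) / 2))) atTop (𝓝 1)) :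
    IsWhittakerW κ μ y := by
  have hd : ∀ x : ℝ, 0 < x → deriv y =ᶠ[𝓝 x] y₁ := fun x hx => by
    filter_upwards [Ioi_mem_nhds hx] with t ht using (h₁ t ht).deriv
  have hdd : ∀ x : ℝ, 0 < x → HasDerivAt (deriv y) (y₂ x) x := fun x hx =>
    (h₂ x hx).congr_of_eventuallyEq (hd x hx)
  refine ⟨fun x hx => (h₁ x hx).differentiableAt, fun x hx => (hdd x hx).differentiableAt,
    fun x hx => ?_, ?_⟩
  · rw [(hdd x hx).deriv]
    exact heq x hx
  · refine (isEquivalent_iff_tendsto_one ?_).2 has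
    filter_upwards [eventually_gt_atTop 0] with x hx
    have hx0 : (x : ℂ) ≠ 0 := Complex.ofReal_ne_zero.2 hx.ne'
    refine mul_ne_zero ?_ (Complex.exp_ne_zero _)
    simp [Complex.cpow_eq_zero_iff, hx0]

theorem hasDerivAt_sqrt_ofReal {x : ℝ} (hx : 0 < x) :
    HasDerivAt (fun x : ℝ => ((Real.sqrt x : ℝ) : ℂ)) (((Real.sqrt x : ℝ) : ℂ) / (2 * x)) x := by
  refine (Real.hasDerivAt_sqrt hx.ne').ofReal_comp.congr_deriv ?_
  have h1 : ((Real.sqrt x : ℝ) : ℂ) ≠ 0 := Complex.ofReal_ne_zero.2 (Real.sqrt_pos.2 hx).ne'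
  have h2 : ((Real.sqrt x : ℝ) : ℂ) ^ 2 = x := by
    rw [← Complex.ofReal_pow, Real.sq_sqrt hx.le]
  push_cast
  rw [← h2]
  field_simp

theorem hasDerivAt_sqrt_mul {f : ℝ → ℂ} {f' : ℂ} {x : ℝ} (hx : 0 < x)
    (hf : HasDerivAt f (f' / x) x) : HasDerivAt (fun x : ℝ => ((Real.sqrt x : ℝ) : ℂ) * f x)
      (((Real.sqrt x : ℝ) : ℂ) * ((f' + f x / 2) / x)) x := by
  have hx0 : (x : ℂ) ≠ 0 := Complex.ofReal_ne_zero.2 hx.ne'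
  refine ((hasDerivAt_sqrt_ofReal hx).mul hf).congr_deriv ?_
  field_simp
  ring

theorem tendsto_sqrt_mul_div {f : ℝ → ℂ} {a : ℂ}
    (hf : Tendsto (fun x : ℝ => f x / ((x : ℂ) ^ a * Complex.exp (-(x : ℂ) / 2))) atTop (𝓝 1)) :
    Tendsto (fun x : ℝ => ((Real.sqrt x : ℝ) : ℂ) * f x
      / ((x : ℂ) ^ (a + 1 / 2) * Complex.exp (-(x : ℂ) / 2))) atTop (𝓝 1) := by
  refine hf.congr' ?_
  filter_upwards [eventually_gt_atTop 0] with x hx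
  have hx0 : (x : ℂ) ≠ 0 := Complex.ofReal_ne_zero.2 hx.ne'
  have e : (x : ℂ) ^ (1 / 2 : ℂ) = ((Real.sqrt x : ℝ) : ℂ) := by
    rw [Real.sqrt_eq_rpow, Complex.ofReal_cpow hx.le]
    norm_num
  have h1 : ((Real.sqrt x : ℝ) : ℂ) ≠ 0 := Complex.ofReal_ne_zero.2 (Real.sqrt_pos.2 hx).ne'
  rw [Complex.cpow_add _ _ hx0, e]
  field_simp

/-- Eliminating `B` from the first order system gives a second order equation for `A`; the factor
`√x` removes its first derivative term and leaves Whittaker's equation. -/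
theorem WhittakerPair.isWhittakerW_fst {μ c a : ℂ} {A B : ℝ → ℂ} (h : WhittakerPair μ c a A B) :
    IsWhittakerW (a + 1 / 2) μ (fun x : ℝ => ((Real.sqrt x : ℝ) : ℂ) * A x) := by
  have d1 := fun (x : ℝ) (hx : 0 < x) =>
    ((((((hasDerivAt_id x).ofReal_comp.div_const 2).const_sub a).mul
      (h.hasDerivAt_fst x hx)).add ((h.hasDerivAt_snd x hx).const_mul (a ^ 2 - μ ^ 2))).add
      ((h.hasDerivAt_fst x hx).div_const 2)).div (hasDerivAt_id x).ofReal_comp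
      (Complex.ofReal_ne_zero.2 hx.ne')
  refine isWhittakerW_of_hasDerivAt
    (fun x hx => hasDerivAt_sqrt_mul hx (h.hasDerivAt_fst x hx))
    (fun x hx => (hasDerivAt_sqrt_ofReal hx).mul (d1 x hx)) (fun x hx => ?_)
    (tendsto_sqrt_mul_div h.infty_fst)
  have hx0 : (x : ℂ) ≠ 0 := Complex.ofReal_ne_zero.2 hx.ne'
  simp only [Pi.add_apply, Pi.mul_apply, id, Complex.ofReal_one]
  field_simp
  ring

theorem WhittakerPair.isWhittakerW_snd {μ c a : ℂ} {A B : ℝ → ℂ} (h : WhittakerPair μ c a A B) :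
    IsWhittakerW (a - 1 / 2) μ (fun x : ℝ => ((Real.sqrt x : ℝ) : ℂ) * B x) := by
  have d1 := fun (x : ℝ) (hx : 0 < x) =>
    ((((((hasDerivAt_id x).ofReal_comp.div_const 2).sub_const a).mul
      (h.hasDerivAt_snd x hx)).sub (h.hasDerivAt_fst x hx)).add
      ((h.hasDerivAt_snd x hx).div_const 2)).div (hasDerivAt_id x).ofReal_comp
      (Complex.ofReal_ne_zero.2 hx.ne')
  refine isWhittakerW_of_hasDerivAt
    (fun x hx => hasDerivAt_sqrt_mul hx (h.hasDerivAt_snd x hx))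
    (fun x hx => (hasDerivAt_sqrt_ofReal hx).mul (d1 x hx)) (fun x hx => ?_) ?_
  · have hx0 : (x : ℂ) ≠ 0 := Complex.ofReal_ne_zero.2 hx.ne'
    simp only [Pi.add_apply, Pi.sub_apply, Pi.mul_apply, id, Complex.ofReal_one]
    field_simp
    ring
  · convert tendsto_sqrt_mul_div h.infty_snd using 6
    ring

theorem WhittakerPair.inv_sqrt_mul_whittakerW_fst {μ c : ℂ} {a : ℝ} {A B : ℝ → ℂ}
    (h : WhittakerPair μ c a A B) {x : ℝ} (hx : 0 < x) :
    (((Real.sqrt x)⁻¹ : ℝ) : ℂ) * whittakerW (a + 1 / 2) μ x = A x := by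
  have h1 := h.isWhittakerW_fst
  have e : (a : ℂ) + 1 / 2 = ((a + 1 / 2 : ℝ) : ℂ) := by push_cast; ring
  rw [e] at h1 ⊢
  rw [whittakerW_eq h1 hx, ← mul_assoc, ← Complex.ofReal_mul,
    inv_mul_cancel₀ (Real.sqrt_pos.2 hx).ne', Complex.ofReal_one, one_mul]

theorem WhittakerPair.inv_sqrt_mul_whittakerW_snd {μ c : ℂ} {a : ℝ} {A B : ℝ → ℂ}
    (h : WhittakerPair μ c a A B) {x : ℝ} (hx : 0 < x) :
    (((Real.sqrt x)⁻¹ : ℝ) : ℂ) * whittakerW (a - 1 / 2) μ x = B x := by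
  have h1 := h.isWhittakerW_snd
  have e : (a : ℂ) - 1 / 2 = ((a - 1 / 2 : ℝ) : ℂ) := by push_cast; ring
  rw [e] at h1 ⊢
  rw [whittakerW_eq h1 hx, ← mul_assoc, ← Complex.ofReal_mul,
    inv_mul_cancel₀ (Real.sqrt_pos.2 hx).ne', Complex.ofReal_one, one_mul]

/-! ### Coefficient identities from the reflection formula -/

/-- `2 μ / sin (2 π μ)`, with its limit value `1 / π` at `μ = 0`. -/
def sinRatio (μ : ℂ) : ℂ :=
  if μ = 0 then 1 / (Real.pi : ℂ) else 2 * μ / Complex.sin (2 * Real.pi * μ)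

theorem pi_ne_zero' : (Real.pi : ℂ) ≠ 0 := Complex.ofReal_ne_zero.2 Real.pi_ne_zero

theorem rGamma_mul_rGamma_neg (z : ℂ) :
    rGamma z * rGamma (-z) = -(z * Complex.sin (Real.pi * z) / Real.pi) := by
  have h := congrArg (fun w : ℂ => w⁻¹) (Complex.Gamma_mul_Gamma_one_sub z)
  simp only [mul_inv, inv_div] at h
  have h2 := rGamma_eq (-z)
  rw [show -z + 1 = 1 - z by ring] at h2
  rw [h2]
  change rGamma z * rGamma (1 - z) = _ at h
  linear_combination (-z) * h

theorem Gamma_mul_Gamma_neg {μ : ℂ} (h0 : μ ≠ 0) :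
    4 * μ ^ 2 * (Complex.Gamma (-(2 * μ)) * Complex.Gamma (2 * μ)) = -Real.pi * sinRatio μ := by
  have h1 := Complex.Gamma_mul_Gamma_one_sub (2 * μ)
  have h2 := Complex.Gamma_add_one (-(2 * μ)) (by simpa using h0)
  rw [show -(2 * μ) + 1 = 1 - 2 * μ by ring] at h2
  rw [h2] at h1
  rw [sinRatio, if_neg h0, show 2 * (Real.pi : ℂ) * μ = Real.pi * (2 * μ) by ring]
  linear_combination (-(2 * μ)) * h1

/-- For `a ± μ = z, z'` the right side is `zz'` times the scale `c`. This fixes the normalization of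
the diagonal blocks. -/
theorem coef_disc (μ c a : ℂ) :
    rGamma (a + μ) * rGamma (a - μ) * (coefS μ a ^ 2 - μ ^ 2 * coefC μ c a ^ 2)
      = (a ^ 2 - μ ^ 2) * (sinRatio μ * (Complex.sin (Real.pi * (a + μ))
        * Complex.sin (Real.pi * (a - μ))) / Real.pi) := by
  have h1 := rGamma_mul_rGamma_neg (a + μ)
  have h2 := rGamma_mul_rGamma_neg (a - μ)
  have hπ := pi_ne_zero'
  rw [coefS, coefC]
  split_ifs with h
  · subst h
    rw [add_zero] at h1
    rw [add_zero, sub_zero, sinRatio, if_pos rfl]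
    calc _ = (rGamma a * rGamma (-a)) ^ 2 := by ring
      _ = _ := by rw [h1]; field_simp; ring
  · have h3 := Gamma_mul_Gamma_neg h
    rw [show -(a + μ) = -μ - a by ring] at h1
    rw [show -(a - μ) = μ - a by ring] at h2
    calc _ = -(4 * μ ^ 2 * (Complex.Gamma (-(2 * μ)) * Complex.Gamma (2 * μ)))
          * ((rGamma (a + μ) * rGamma (-μ - a)) * (rGamma (a - μ) * rGamma (μ - a))) := by ring
      _ = _ := by rw [h1, h2, h3]; field_simp; ring

/-- The Casoratian-type combination of coefficients at `a` and `-a` for `μ = 0`. -/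
theorem coef_cross_zero (c a : ℂ) :
    coefS 0 a * coefC 0 c (-a) - coefC 0 c a * coefS 0 (-a)
      = (Complex.sin (Real.pi * a) + Real.pi * a * Complex.cos (Real.pi * a)) / Real.pi := by
  -- The identity is the derivative at `a` of the reflection formula for `1/(Γ(s)Γ(-s))`; the terms
  -- in `c` cancel.
  have d1 : HasDerivAt (fun s => rGamma s * rGamma (-s))
      (deriv rGamma a * rGamma (-a) + rGamma a * -deriv rGamma (-a)) a := by
    refine (differentiable_rGamma a).hasDerivAt.mul ?_
    have := (differentiable_rGamma (-a)).hasDerivAt.comp a (hasDerivAt_neg a)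
    simpa [Function.comp_def] using this
  have d2 : HasDerivAt (fun s : ℂ => -(s * Complex.sin (Real.pi * s) / Real.pi))
      (-((1 * Complex.sin (Real.pi * a) + a * (Complex.cos (Real.pi * a) * (Real.pi * 1)))
        / Real.pi)) a :=
    (((hasDerivAt_id a).mul (((hasDerivAt_id a).const_mul (Real.pi : ℂ)).csin)).div_const _).neg
  rw [show (fun s : ℂ => -(s * Complex.sin (Real.pi * s) / Real.pi))
    = fun s => rGamma s * rGamma (-s) from funext fun s => (rGamma_mul_rGamma_neg s).symm] at d2
  have e := d1.unique d2
  simp only [coefS, coefC, if_true, neg_neg]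
  linear_combination -e

theorem coef_cross_fst {μ : ℂ} (h : μ ≠ 0) (c a : ℂ) :
    2 * μ * (coefS μ a * coefC μ c (-a) - coefC μ c a * coefS μ (-a))
      = sinRatio μ * ((a + μ) * Complex.sin (Real.pi * (a + μ))
        - (a - μ) * Complex.sin (Real.pi * (a - μ))) := by
  have h1 := rGamma_mul_rGamma_neg (a + μ)
  have h2 := rGamma_mul_rGamma_neg (a - μ)
  have h3 := Gamma_mul_Gamma_neg h
  have hπ := pi_ne_zero'
  simp only [coefS, coefC, if_neg h]
  rw [show -(a + μ) = -μ - a by ring] at h1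
  rw [show -(a - μ) = μ - a by ring] at h2
  rw [show -μ - -a = a - μ by ring, show μ - -a = a + μ by ring]
  calc _ = (4 * μ ^ 2 * (Complex.Gamma (-(2 * μ)) * Complex.Gamma (2 * μ)))
          * ((rGamma (a + μ) * rGamma (-μ - a)) - (rGamma (a - μ) * rGamma (μ - a))) := by ring
    _ = _ := by rw [h1, h2, h3]; field_simp; ring

theorem coef_cross_snd (μ c a : ℂ) :
    2 * (coefS μ a * coefS μ (-a) - μ ^ 2 * (coefC μ c a * coefC μ c (-a)))
      = -sinRatio μ * ((a + μ) * Complex.sin (Real.pi * (a + μ))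
        + (a - μ) * Complex.sin (Real.pi * (a - μ))) := by
  have h1 := rGamma_mul_rGamma_neg (a + μ)
  have h2 := rGamma_mul_rGamma_neg (a - μ)
  have hπ := pi_ne_zero'
  simp only [coefS, coefC]
  split_ifs with h
  · subst h
    rw [add_zero] at h1
    rw [neg_neg, add_zero, sub_zero, sinRatio, if_pos rfl]
    calc _ = 2 * (rGamma a * rGamma (-a)) := by ring
      _ = _ := by rw [h1]; ring
  · have h3 := Gamma_mul_Gamma_neg h
    rw [show -(a + μ) = -μ - a by ring] at h1
    rw [show -(a - μ) = μ - a by ring] at h2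
    rw [show -μ - -a = a - μ by ring, show μ - -a = a + μ by ring]
    calc _ = -(4 * μ ^ 2 * (Complex.Gamma (-(2 * μ)) * Complex.Gamma (2 * μ)))
          * ((rGamma (a + μ) * rGamma (-μ - a)) + (rGamma (a - μ) * rGamma (μ - a))) := by ring
      _ = _ := by rw [h1, h2, h3]; field_simp; ring

/-- The coefficient of `cosh (μ log (x / y))` in the off-diagonal limit. -/
def crossC (μ a : ℂ) : ℂ :=
  if μ = 0 then Complex.cos (Real.pi * a)
  else Complex.cos (Real.pi * a) * Complex.sin (Real.pi * μ) * sinRatio μ / μ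

/-- The left side is the coefficient of `cosh (μ (log x - log y))` in the off-diagonal form after
multiplication by `a² - μ²`; `coef_crossS` does the same for the `sinhDiv` term. -/
theorem coef_crossC (μ c a : ℂ) :
    (coefS μ a * coefS μ (-a) - μ ^ 2 * (coefC μ c a * coefC μ c (-a)))
      + a * (coefS μ a * coefC μ c (-a) - coefC μ c a * coefS μ (-a))
      = (a ^ 2 - μ ^ 2) * crossC μ a := by
  have h2 := coef_cross_snd μ c a
  have hπ := pi_ne_zero'
  rw [crossC]
  split_ifs with h
  · subst h
    have h1 := coef_cross_zero c a
    rw [h1]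
    rw [sinRatio, if_pos rfl, add_zero, sub_zero] at h2
    have h3 : (Real.pi : ℂ) * (Real.pi : ℂ)⁻¹ = 1 := mul_inv_cancel₀ hπ
    linear_combination h2 / 2 + a ^ 2 * Complex.cos (Real.pi * a) * h3
  · have h1 := coef_cross_fst h c a
    rw [mul_add (Real.pi : ℂ), mul_sub (Real.pi : ℂ), Complex.sin_add, Complex.sin_sub] at h1 h2
    have h3 : μ * μ⁻¹ = 1 := mul_inv_cancel₀ h
    refine mul_left_cancel₀ (mul_ne_zero two_ne_zero h) ?_
    rw [show 2 * μ * ((a ^ 2 - μ ^ 2) * (Complex.cos (Real.pi * a) * Complex.sin (Real.pi * μ)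
      * sinRatio μ / μ)) = 2 * ((a ^ 2 - μ ^ 2) * (Complex.cos (Real.pi * a)
      * Complex.sin (Real.pi * μ) * sinRatio μ)) by field_simp]
    linear_combination μ * h2 + a * h1

theorem coef_crossS (μ c a : ℂ) :
    μ ^ 2 * (coefS μ a * coefC μ c (-a) - coefC μ c a * coefS μ (-a))
      + a * (coefS μ a * coefS μ (-a) - μ ^ 2 * (coefC μ c a * coefC μ c (-a)))
      = -((a ^ 2 - μ ^ 2)
        * (Complex.sin (Real.pi * a) * Complex.cos (Real.pi * μ) * sinRatio μ)) := by
  have h2 := coef_cross_snd μ c a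
  by_cases h : μ = 0
  · subst h
    rw [add_zero, sub_zero] at h2
    simp only [mul_zero, Complex.cos_zero]
    linear_combination a / 2 * h2
  · have h1 := coef_cross_fst h c a
    rw [mul_add (Real.pi : ℂ), mul_sub (Real.pi : ℂ), Complex.sin_add, Complex.sin_sub] at h1 h2
    linear_combination a / 2 * h2 + μ / 2 * h1

/-! ### Consequences of admissibility -/

theorem div_sin_pos {t : ℝ} (h0 : t ≠ 0) (h1 : -1 < t) (h2 : t < 1) :
    0 < t / Real.sin (Real.pi * t) := by
  rcases lt_or_gt_of_ne h0 with h | h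
  · refine div_pos_of_neg_of_neg h (Real.sin_neg_of_neg_of_neg_pi_lt ?_ ?_)
    · nlinarith [Real.pi_pos]
    · nlinarith [Real.pi_pos]
  · refine div_pos h (Real.sin_pos_of_pos_of_lt_pi ?_ ?_)
    · nlinarith [Real.pi_pos]
    · nlinarith [Real.pi_pos]

theorem sin_mul_sin_pos {m : ℤ} {r r' : ℝ} (h1 : m < r) (h2 : r < m + 1) (h3 : m < r')
    (h4 : r' < m + 1) : 0 < Real.sin (Real.pi * r) * Real.sin (Real.pi * r') := by
  have e : ∀ t : ℝ, Real.sin (Real.pi * t) = (-1) ^ m * Real.sin (Real.pi * (t - m)) := by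
    intro t
    rw [← Real.sin_add_int_mul_pi]
    congr 1
    ring
  have pos : ∀ t : ℝ, m < t → t < m + 1 → 0 < Real.sin (Real.pi * (t - m)) := by
    intro t ht ht'
    refine Real.sin_pos_of_pos_of_lt_pi ?_ ?_
    · nlinarith [Real.pi_pos]
    · nlinarith [Real.pi_pos]
  have hm : ((-1 : ℝ) ^ m) * (-1) ^ m = 1 := by
    rw [← mul_zpow]
    simp
  rw [e r, e r', show (-1 : ℝ) ^ m * Real.sin (Real.pi * (r - m)) * ((-1) ^ m
    * Real.sin (Real.pi * (r' - m))) = ((-1 : ℝ) ^ m * (-1) ^ m) * (Real.sin (Real.pi * (r - m))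
    * Real.sin (Real.pi * (r' - m))) by ring, hm, one_mul]
  exact mul_pos (pos r h1 h2) (pos r' h3 h4)

/-- In the conjugate case `μ` is purely imaginary and its sine becomes a `sinh`. In the real case
`|z - z'| < 1` and the two sines have equal sign. Neither parameter is an integer, so `zz' ≠ 0`. -/
theorem Admissible.exists_params {z z' : ℂ} (h : Admissible z z') :
    ∃ a s r : ℝ, 0 < s ∧ 0 < r ∧ parA z z' = a ∧ -1 / 2 < (parMu z z').re
      ∧ (parMu z z').re < 1 / 2 ∧ z * z' ≠ 0 ∧ sinProd z z' = s ∧ sinRatio (parMu z z') = r := by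
  rcases h with ⟨rfl, hz⟩ | ⟨r, r', rfl, rfl, m, h1, h2, h3, h4⟩
  · have hz0 : z ≠ 0 := by simpa using hz 0
    have hs : Complex.sin (Real.pi * z) ≠ 0 := by
      intro h0
      obtain ⟨k, hk⟩ := Complex.sin_eq_zero_iff.1 h0
      exact hz k (mul_left_cancel₀ pi_ne_zero' (hk.trans (mul_comm _ _)))
    have hμ : parMu z ((starRingEnd ℂ) z) = (z.im : ℂ) * Complex.I := by
      rw [parMu, Complex.sub_conj]
      push_cast
      ring
    refine ⟨z.re, Complex.normSq (Complex.sin (Real.pi * z)),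
      if z.im = 0 then 1 / Real.pi else 2 * z.im / Real.sinh (2 * Real.pi * z.im),
      Complex.normSq_pos.2 hs, ?_, ?_, ?_, ?_, ?_, ?_, ?_⟩
    · split_ifs with h0
      · positivity
      · rcases lt_or_gt_of_ne h0 with h | h
        · refine div_pos_of_neg_of_neg (by linarith) (Real.sinh_neg_iff.2 ?_)
          nlinarith [Real.pi_pos]
        · exact div_pos (by linarith) (Real.sinh_pos_iff.2 (by positivity))
    · rw [parA, Complex.add_conj]
      push_cast
      ring
    · rw [hμ]; simp; norm_num
    · rw [hμ]; simp
    · exact mul_ne_zero hz0 (by simpa using hz0)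
    · rw [sinProd, ← Complex.mul_conj, ← Complex.sin_conj, map_mul, Complex.conj_ofReal]
    · rw [hμ, sinRatio]
      simp only [mul_eq_zero, Complex.I_ne_zero, or_false, Complex.ofReal_eq_zero]
      split_ifs with h0
      · push_cast; rfl
      · rw [show 2 * (Real.pi : ℂ) * (z.im * Complex.I) = (2 * Real.pi * z.im : ℂ) * Complex.I by
          ring, Complex.sin_mul_I]
        push_cast
        rw [← mul_assoc, mul_div_mul_right _ _ Complex.I_ne_zero]
  · have hμ : parMu (r : ℂ) (r' : ℂ) = (((r - r') / 2 : ℝ) : ℂ) := by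
      rw [parMu]; push_cast; ring
    have hr0 : r ≠ 0 := by
      rintro rfl
      have h5 : m < 0 := by exact_mod_cast h1
      have h6 : (m : ℝ) + 1 ≤ 0 := by exact_mod_cast h5
      linarith
    have hr0' : r' ≠ 0 := by
      rintro rfl
      have h5 : m < 0 := by exact_mod_cast h3
      have h6 : (m : ℝ) + 1 ≤ 0 := by exact_mod_cast h5
      linarith
    refine ⟨(r + r') / 2, Real.sin (Real.pi * r) * Real.sin (Real.pi * r'),
      if r - r' = 0 then 1 / Real.pi else (r - r') / Real.sin (Real.pi * (r - r')),
      sin_mul_sin_pos h1 h2 h3 h4, ?_, ?_, ?_, ?_, ?_, ?_, ?_⟩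
    · split_ifs with h0
      · positivity
      · exact div_sin_pos h0 (by linarith) (by linarith)
    · rw [parA]; push_cast; ring
    · rw [hμ, Complex.ofReal_re]; linarith
    · rw [hμ, Complex.ofReal_re]; linarith
    · exact mul_ne_zero (Complex.ofReal_ne_zero.2 hr0) (Complex.ofReal_ne_zero.2 hr0')
    · rw [sinProd]; push_cast; ring
    · rw [hμ, sinRatio]
      have e : (r - r') / 2 = 0 ↔ r - r' = 0 := by simp
      simp only [Complex.ofReal_eq_zero, e]
      split_ifs with h0
      · push_cast; rfl
      · push_cast
        congr 1
        · ring
        · congr 1; ring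

/-! ### Bilinear forms in the leading parts -/

theorem sinhDiv_sub (μ s t : ℂ) : sinhDiv μ (s - t)
    = sinhDiv μ s * Complex.cosh (μ * t) - Complex.cosh (μ * s) * sinhDiv μ t := by
  simp only [sinhDiv]
  split_ifs with h
  · simp [h]
  · rw [mul_sub, Complex.sinh_sub]
    ring

theorem cosh_mul_sub (μ s t : ℂ) : Complex.cosh (μ * (s - t))
    = Complex.cosh (μ * s) * Complex.cosh (μ * t) - μ ^ 2 * (sinhDiv μ s * sinhDiv μ t) := by
  rw [mul_sub, Complex.cosh_sub, ← mul_sinhDiv, ← mul_sinhDiv]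
  ring

theorem sinhDiv_neg (μ s : ℂ) : sinhDiv μ (-s) = -sinhDiv μ s := by
  simp only [sinhDiv]
  split_ifs with h
  · rfl
  · rw [mul_neg, Complex.sinh_neg, neg_div]

theorem sub_mul_zeroMain (μ c a : ℂ) (x : ℝ) : (a ^ 2 - μ ^ 2) * zeroMain μ c (a - 1) x
    = (coefS μ a - a * coefC μ c a) * Complex.cosh (μ * Real.log x)
      + (μ ^ 2 * coefC μ c a - a * coefS μ a) * sinhDiv μ (Real.log x) := by
  rw [← sub_mul_coefC, ← sub_mul_coefS, zeroMain]
  ring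

/-- The Euler system has a trace-free constant matrix in `log x`, so its determinant form is
dilation invariant. The constant in front is the discriminant of the leading part. -/
theorem zeroMain_wronskian {μ a : ℂ} (h0 : a ^ 2 - μ ^ 2 ≠ 0) (c : ℂ) (x y : ℝ) :
    zeroMain μ c a x * zeroMain μ c (a - 1) y - zeroMain μ c (a - 1) x * zeroMain μ c a y
      = (coefS μ a ^ 2 - μ ^ 2 * coefC μ c a ^ 2) / (a ^ 2 - μ ^ 2)
        * sinhDiv μ (Real.log x - Real.log y) := by
  have hx := sub_mul_zeroMain μ c a x
  have hy := sub_mul_zeroMain μ c a y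
  rw [sinhDiv_sub, div_mul_eq_mul_div, eq_div_iff h0]
  have ex : zeroMain μ c a x = coefC μ c a * Complex.cosh (μ * Real.log x)
    + coefS μ a * sinhDiv μ (Real.log x) := rfl
  have ey : zeroMain μ c a y = coefC μ c a * Complex.cosh (μ * Real.log y)
    + coefS μ a * sinhDiv μ (Real.log y) := rfl
  rw [ex, ey]
  linear_combination (coefC μ c a * Complex.cosh (μ * Real.log x)
    + coefS μ a * sinhDiv μ (Real.log x)) * hy - (coefC μ c a * Complex.cosh (μ * Real.log y)
    + coefS μ a * sinhDiv μ (Real.log y)) * hx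

/-- This is the diagonal counterpart of `zeroMain_wronskian`: the quadratic form is `x (A'B - B'A)`
written through the Euler system, and it is conserved. -/
theorem zeroMain_quadratic {μ a : ℂ} (h0 : a ^ 2 - μ ^ 2 ≠ 0) (c : ℂ) (x : ℝ) :
    zeroMain μ c a x * zeroMain μ c a x
      + (a ^ 2 - μ ^ 2) * (zeroMain μ c (a - 1) x * zeroMain μ c (a - 1) x)
      + 2 * a * (zeroMain μ c a x * zeroMain μ c (a - 1) x)
      = (coefS μ a ^ 2 - μ ^ 2 * coefC μ c a ^ 2) / (a ^ 2 - μ ^ 2) := by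
  have hx := sub_mul_zeroMain μ c a x
  have h1 := cosh_mul_sub μ (Real.log x) (Real.log x)
  rw [sub_self, mul_zero, Complex.cosh_zero] at h1
  rw [eq_div_iff h0]
  have ex : zeroMain μ c a x = coefC μ c a * Complex.cosh (μ * Real.log x)
    + coefS μ a * sinhDiv μ (Real.log x) := rfl
  set C := Complex.cosh (μ * Real.log x)
  set S := sinhDiv μ (Real.log x)
  set W := zeroMain μ c (a - 1) x
  rw [ex]
  linear_combination ((a ^ 2 - μ ^ 2) * W + ((coefS μ a - a * coefC μ c a) * C
      + (μ ^ 2 * coefC μ c a - a * coefS μ a) * S) + 2 * a * (coefC μ c a * C + coefS μ a * S)) * hx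
    - (coefS μ a ^ 2 - μ ^ 2 * coefC μ c a ^ 2) * h1

theorem zeroMain_cross {μ a : ℂ} (h0 : a ^ 2 - μ ^ 2 ≠ 0) (c : ℂ) (x y : ℝ) :
    zeroMain μ c a x * zeroMain μ c (-a) y
      + (a ^ 2 - μ ^ 2) * (zeroMain μ c (a - 1) x * zeroMain μ c (-a - 1) y)
      = crossC μ a * Complex.cosh (μ * (Real.log x - Real.log y))
        + Complex.sin (Real.pi * a) * Complex.cos (Real.pi * μ) * sinRatio μ
          * sinhDiv μ (Real.log x - Real.log y) := by
  have hx := sub_mul_zeroMain μ c a x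
  have hy := sub_mul_zeroMain μ c (-a) y
  rw [neg_sq] at hy
  have k1 := coef_crossC μ c a
  have k2 := coef_crossS μ c a
  refine mul_left_cancel₀ h0 ?_
  rw [mul_add (a ^ 2 - μ ^ 2) (crossC μ a * _), ← mul_assoc _ (crossC μ a), ← k1,
    ← mul_assoc (a ^ 2 - μ ^ 2) (Complex.sin _ * _ * _), ← neg_eq_iff_eq_neg.2 k2, sinhDiv_sub,
    cosh_mul_sub]
  have ex : zeroMain μ c a x = coefC μ c a * Complex.cosh (μ * Real.log x)
    + coefS μ a * sinhDiv μ (Real.log x) := rfl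
  have ey : zeroMain μ c (-a) y = coefC μ c (-a) * Complex.cosh (μ * Real.log y)
    + coefS μ (-a) * sinhDiv μ (Real.log y) := rfl
  rw [ex, ey]
  linear_combination (a ^ 2 - μ ^ 2) * zeroMain μ c (-a - 1) y * hx
    + ((coefS μ a - a * coefC μ c a) * Complex.cosh (μ * Real.log x)
      + (μ ^ 2 * coefC μ c a - a * coefS μ a) * sinhDiv μ (Real.log x)) * hy

/-! ### Limits at zero along proportional arguments -/

section Limits

variable {X Y : ℝ → ℝ} {q : ℝ}

/-- With `X = q Y` the powers of the two arguments cancel up to the constant `q^r`, so the little-o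
factor decides. -/
theorem tendsto_mul_of_isBigO {F G : ℝ → ℂ} {r : ℝ} (hF : F =O[𝓝[>] 0] fun x : ℝ => x ^ r)
    (hG : G =o[𝓝[>] 0] fun x : ℝ => x ^ (-r)) (hq : 0 < q) (hX : Tendsto X atTop (𝓝[>] 0))
    (hY : Tendsto Y atTop (𝓝[>] 0)) (hXY : ∀ t, X t = q * Y t) :
    Tendsto (fun t => F (X t) * G (Y t)) atTop (𝓝 0) := by
  have h := (hF.comp_tendsto hX).mul_isLittleO (hG.comp_tendsto hY)
  have h2 : (fun t => F (X t) * G (Y t)) =o[atTop] fun _ => q ^ r := by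
    refine h.congr' EventuallyEq.rfl ?_
    filter_upwards [hY.eventually self_mem_nhdsWithin] with t ht
    have ht' : 0 < Y t := ht
    simp only [Function.comp]
    rw [hXY, Real.mul_rpow hq.le ht'.le, mul_assoc, ← Real.rpow_add ht', add_neg_cancel,
      Real.rpow_zero, mul_one]
  exact (isLittleO_const_iff (Real.rpow_pos_of_pos hq r).ne').1 h2

/-- Write `fg - mn = (f - m) g + m (g - n)`; each summand pairs `O(x^{1/2})` with `o(x^{-1/2})`. -/
theorem tendsto_mul_sub_mul {f g m n : ℝ → ℂ}
    (hf : (fun x => f x - m x) =O[𝓝[>] 0] fun x : ℝ => x ^ (1 / 2 : ℝ))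
    (hg : (fun x => g x - n x) =O[𝓝[>] 0] fun x : ℝ => x ^ (1 / 2 : ℝ))
    (hm : m =o[𝓝[>] 0] fun x : ℝ => x ^ (-1 / 2 : ℝ))
    (hg' : g =o[𝓝[>] 0] fun x : ℝ => x ^ (-1 / 2 : ℝ)) (hq : 0 < q)
    (hX : Tendsto X atTop (𝓝[>] 0)) (hY : Tendsto Y atTop (𝓝[>] 0)) (hXY : ∀ t, X t = q * Y t) :
    Tendsto (fun t => f (X t) * g (Y t) - m (X t) * n (Y t)) atTop (𝓝 0) := by
  have e : -(1 / 2 : ℝ) = -1 / 2 := by norm_num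
  have t1 := tendsto_mul_of_isBigO hf (by rw [e]; exact hg') hq hX hY hXY
  have t2 := tendsto_mul_of_isBigO hg (by rw [e]; exact hm) (inv_pos.2 hq) hY hX
    (fun t => by rw [hXY, inv_mul_cancel_left₀ hq.ne'])
  have := t1.add t2
  rw [add_zero] at this
  refine this.congr fun t => ?_
  ring

variable {μ c a : ℂ} {A B A' B' : ℝ → ℂ}

theorem WhittakerPair.tendsto_wronskian (h : WhittakerPair μ c a A B) (h1 : -1 / 2 < μ.re)
    (h2 : μ.re < 1 / 2) (h0 : a ^ 2 - μ ^ 2 ≠ 0) (hq : 0 < q) (hX : Tendsto X atTop (𝓝[>] 0))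
    (hY : Tendsto Y atTop (𝓝[>] 0)) (hXY : ∀ t, X t = q * Y t) :
    Tendsto (fun t => A (X t) * B (Y t) - B (X t) * A (Y t)) atTop
      (𝓝 ((coefS μ a ^ 2 - μ ^ 2 * coefC μ c a ^ 2) / (a ^ 2 - μ ^ 2)
        * sinhDiv μ (Real.log q))) := by
  have t1 := tendsto_mul_sub_mul h.zero_fst h.zero_snd (isLittleO_zeroMain h1 h2 c a)
    (h.isLittleO_snd h1 h2) hq hX hY hXY
  have t2 := tendsto_mul_sub_mul h.zero_snd h.zero_fst (isLittleO_zeroMain h1 h2 c (a - 1))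
    (h.isLittleO_fst h1 h2) hq hX hY hXY
  have := (t1.sub t2).add_const ((coefS μ a ^ 2 - μ ^ 2 * coefC μ c a ^ 2) / (a ^ 2 - μ ^ 2)
    * sinhDiv μ (Real.log q))
  rw [sub_zero, zero_add] at this
  refine this.congr' ?_
  filter_upwards [hY.eventually self_mem_nhdsWithin] with t ht
  have ht' : 0 < Y t := ht
  have e : ((Real.log (X t) : ℝ) : ℂ) - ((Real.log (Y t) : ℝ) : ℂ) = ((Real.log q : ℝ) : ℂ) := by
    rw [hXY, Real.log_mul hq.ne' ht'.ne']
    push_cast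
    ring
  have := zeroMain_wronskian h0 c (X t) (Y t)
  rw [e] at this
  rw [← this]
  ring

theorem WhittakerPair.tendsto_cross (h : WhittakerPair μ c a A B)
    (h' : WhittakerPair μ c (-a) A' B') (h1 : -1 / 2 < μ.re) (h2 : μ.re < 1 / 2)
    (h0 : a ^ 2 - μ ^ 2 ≠ 0) (hq : 0 < q) (hX : Tendsto X atTop (𝓝[>] 0))
    (hY : Tendsto Y atTop (𝓝[>] 0)) (hXY : ∀ t, X t = q * Y t) :
    Tendsto (fun t => A (X t) * A' (Y t) + (a ^ 2 - μ ^ 2) * (B (X t) * B' (Y t))) atTop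
      (𝓝 (crossC μ a * Complex.cosh (μ * Real.log q)
        + Complex.sin (Real.pi * a) * Complex.cos (Real.pi * μ) * sinRatio μ
          * sinhDiv μ (Real.log q))) := by
  have t1 := tendsto_mul_sub_mul h.zero_fst h'.zero_fst (isLittleO_zeroMain h1 h2 c a)
    (h'.isLittleO_fst h1 h2) hq hX hY hXY
  have t2 := tendsto_mul_sub_mul h.zero_snd h'.zero_snd (isLittleO_zeroMain h1 h2 c (a - 1))
    (h'.isLittleO_snd h1 h2) hq hX hY hXY
  have := (t1.add (t2.const_mul (a ^ 2 - μ ^ 2))).add_const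
    (crossC μ a * Complex.cosh (μ * Real.log q) + Complex.sin (Real.pi * a)
      * Complex.cos (Real.pi * μ) * sinRatio μ * sinhDiv μ (Real.log q))
  rw [mul_zero, zero_add, zero_add] at this
  refine this.congr' ?_
  filter_upwards [hY.eventually self_mem_nhdsWithin] with t ht
  have ht' : 0 < Y t := ht
  have e : ((Real.log (X t) : ℝ) : ℂ) - ((Real.log (Y t) : ℝ) : ℂ) = ((Real.log q : ℝ) : ℂ) := by
    rw [hXY, Real.log_mul hq.ne' ht'.ne']
    push_cast
    ring
  have := zeroMain_cross h0 c (X t) (Y t)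
  rw [e] at this
  rw [← this]
  ring

/-- The system gives `x (A'B - B'A) = A² + (a² - μ²) B² + 2a AB - x AB`, whose last term is
negligible at zero. -/
theorem WhittakerPair.tendsto_quadratic (h : WhittakerPair μ c a A B) (h1 : -1 / 2 < μ.re)
    (h2 : μ.re < 1 / 2) (h0 : a ^ 2 - μ ^ 2 ≠ 0) (hX : Tendsto X atTop (𝓝[>] 0)) :
    Tendsto (fun t => X t * (deriv A (X t) * B (X t) - deriv B (X t) * A (X t))) atTop
      (𝓝 ((coefS μ a ^ 2 - μ ^ 2 * coefC μ c a ^ 2) / (a ^ 2 - μ ^ 2))) := by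
  have hXX : ∀ t, X t = 1 * X t := fun t => (one_mul _).symm
  have t1 := tendsto_mul_sub_mul h.zero_fst h.zero_fst (isLittleO_zeroMain h1 h2 c a)
    (h.isLittleO_fst h1 h2) one_pos hX hX hXX
  have t2 := tendsto_mul_sub_mul h.zero_snd h.zero_snd (isLittleO_zeroMain h1 h2 c (a - 1))
    (h.isLittleO_snd h1 h2) one_pos hX hX hXX
  have t3 := tendsto_mul_sub_mul h.zero_fst h.zero_snd (isLittleO_zeroMain h1 h2 c a)
    (h.isLittleO_snd h1 h2) one_pos hX hX hXX
  have b1 := isBigO_mul_rpow (f := fun x : ℝ => (x : ℂ)) (r := 1) (q := 1 / 2)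
    (by simpa using isBigO_cpow_rpow 1) (h.isLittleO_fst h1 h2).isBigO (by norm_num)
  have t4 := tendsto_mul_of_isBigO b1
    (by rw [show -(1 / 2 : ℝ) = -1 / 2 by norm_num]; exact h.isLittleO_snd h1 h2) one_pos hX hX hXX
  have := (((t1.add (t2.const_mul (a ^ 2 - μ ^ 2))).add (t3.const_mul (2 * a))).sub t4).add_const
    ((coefS μ a ^ 2 - μ ^ 2 * coefC μ c a ^ 2) / (a ^ 2 - μ ^ 2))
  simp only [mul_zero, zero_add, sub_zero] at this
  refine this.congr' ?_
  filter_upwards [hX.eventually self_mem_nhdsWithin] with t ht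
  have ht' : 0 < X t := ht
  have ht0 : ((X t : ℝ) : ℂ) ≠ 0 := Complex.ofReal_ne_zero.2 ht'.ne'
  rw [(h.hasDerivAt_fst _ ht').deriv, (h.hasDerivAt_snd _ ht').deriv,
    ← zeroMain_quadratic h0 c (X t)]
  field_simp
  ring

end Limits

/-! ### Logarithmic variable and limits of the blocks -/

theorem expVar_pos (c ξ : ℝ) : 0 < expVar c ξ := Real.exp_pos _

theorem tendsto_expVar {c : ℝ} (hc : 0 < c) (ξ : ℝ) :
    Tendsto (fun M : ℝ => expVar c (ξ + M)) atTop (𝓝[>] 0) := by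
  refine tendsto_nhdsWithin_iff.2 ⟨?_, Eventually.of_forall fun M => Real.exp_pos _⟩
  refine Real.tendsto_exp_atBot.comp ?_
  exact (tendsto_neg_atTop_atBot.comp (tendsto_atTop_add_const_left _ ξ tendsto_id)).atBot_div_const
    hc

theorem expVar_eq_mul {c ξ η M : ℝ} :
    expVar c (ξ + M) = Real.exp (-(ξ - η) / c) * expVar c (η + M) := by
  rw [expVar, expVar, ← Real.exp_add]
  congr 1
  ring

theorem sqrt_expVar_mul {c : ℝ} (hc : 0 < c) (ξ η : ℝ) :
    Real.sqrt (expVar c ξ / c) * Real.sqrt (expVar c η / c)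
      = Real.exp (-(ξ + η) / (2 * c)) / c := by
  rw [← Real.sqrt_mul (div_nonneg (expVar_pos _ _).le hc.le),
    show expVar c ξ / c * (expVar c η / c) = (Real.exp (-(ξ + η) / (2 * c)) / c) ^ 2 by
      rw [expVar, expVar, div_mul_div_comm, ← Real.exp_add, div_pow, ← Real.exp_nat_mul, sq c]
      congr 2
      push_cast
      field_simp
      ring]
  exact Real.sqrt_sq (by positivity)

/-- The exponential factor is `√(xy)`. It cancels against the Jacobian, leaving a denominator
independent of `M`. -/
theorem expVar_sub_expVar {c : ℝ} (hc : 0 < c) (ξ η : ℝ) : expVar c ξ - expVar c η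
    = Real.exp (-(ξ + η) / (2 * c)) * (2 * Real.sinh (-(ξ - η) / (2 * c))) := by
  rw [Real.sinh_eq, expVar, expVar, mul_div_cancel₀ _ two_ne_zero, mul_sub, ← Real.exp_add,
    ← Real.exp_add]
  congr 2 <;> field_simp <;> ring

theorem expVar_add_expVar {c : ℝ} (hc : 0 < c) (ξ η : ℝ) : expVar c ξ + expVar c η
    = Real.exp (-(ξ + η) / (2 * c)) * (2 * Real.cosh (-(ξ - η) / (2 * c))) := by
  rw [Real.cosh_eq, expVar, expVar, mul_div_cancel₀ _ two_ne_zero, mul_add, ← Real.exp_add,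
    ← Real.exp_add]
  congr 2 <;> field_simp <;> ring

theorem divDiffKernel_congr {f g A B : ℝ → ℂ} (hf : ∀ x, 0 < x → f x = A x)
    (hg : ∀ x, 0 < x → g x = B x) {x y : ℝ} (hx : 0 < x) (hy : 0 < y) :
    divDiffKernel f g x y = divDiffKernel A B x y := by
  have e1 : f =ᶠ[𝓝 x] A := by filter_upwards [Ioi_mem_nhds hx] with t ht using hf t ht
  have e2 : g =ᶠ[𝓝 x] B := by filter_upwards [Ioi_mem_nhds hx] with t ht using hg t ht
  rw [divDiffKernel, divDiffKernel, e1.deriv_eq, e2.deriv_eq, hf x hx, hg x hx, hf y hy, hg y hy]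

/-- The limit of a diagonal block. -/
def diagLimit (μ : ℂ) (c ζ : ℝ) : ℂ :=
  if ζ = 0 then 1 else sinhDiv μ ((ζ / c : ℝ) : ℂ) / (2 * Complex.sinh ((ζ / (2 * c) : ℝ) : ℂ))

/-- The hypothesis `hg` is the content of `coef_disc` with `g` the Gamma prefactor; it makes the
bilinear constant equal to `c`, cancelling the Jacobian's `1/c`. Off the diagonal the Wronskian
limit applies, on it the quadratic one. -/
theorem WhittakerPair.tendsto_diag {μ c₀ a : ℂ} {A B : ℝ → ℂ} (h : WhittakerPair μ c₀ a A B)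
    (h1 : -1 / 2 < μ.re) (h2 : μ.re < 1 / 2) (h0 : a ^ 2 - μ ^ 2 ≠ 0) {c : ℝ} (hc : 0 < c) {g : ℂ}
    (hg : g * (coefS μ a ^ 2 - μ ^ 2 * coefC μ c₀ a ^ 2) = (a ^ 2 - μ ^ 2) * c) (ξ η : ℝ) :
    Tendsto (fun M : ℝ => ((Real.sqrt (expVar c (ξ + M) / c) * Real.sqrt (expVar c (η + M) / c) : ℝ)
      : ℂ) * (g * divDiffKernel A B (expVar c (ξ + M)) (expVar c (η + M)))) atTop
      (𝓝 (diagLimit μ c (ξ - η))) := by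
  have hc0 : (c : ℂ) ≠ 0 := Complex.ofReal_ne_zero.2 hc.ne'
  have hD : g * ((coefS μ a ^ 2 - μ ^ 2 * coefC μ c₀ a ^ 2) / (a ^ 2 - μ ^ 2)) = c := by
    rw [← mul_div_assoc, hg, mul_div_cancel_left₀ _ h0]
  by_cases hξ : ξ = η
  · subst hξ
    rw [diagLimit, if_pos (sub_self _)]
    have t := ((h.tendsto_quadratic h1 h2 h0 (tendsto_expVar hc ξ)).const_mul g).const_mul
      (c : ℂ)⁻¹
    rw [hD, inv_mul_cancel₀ hc0] at t
    refine t.congr fun M => ?_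
    rw [divDiffKernel, if_pos rfl, Real.mul_self_sqrt (div_nonneg (expVar_pos _ _).le hc.le)]
    push_cast
    ring
  · have hζ : ξ - η ≠ 0 := sub_ne_zero.2 hξ
    rw [diagLimit, if_neg hζ]
    have t := ((h.tendsto_wronskian h1 h2 h0 (Real.exp_pos _) (tendsto_expVar hc ξ)
      (tendsto_expVar hc η) (fun M => expVar_eq_mul)).const_mul g).const_mul
      ((c : ℂ)⁻¹ * (2 * Complex.sinh ((-(ξ - η) / (2 * c) : ℝ) : ℂ))⁻¹)
    have e1 : (((-(ξ - η) / c : ℝ)) : ℂ) = -(((ξ - η) / c : ℝ) : ℂ) := by push_cast; ring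
    have e2 : (((-(ξ - η) / (2 * c) : ℝ)) : ℂ) = -(((ξ - η) / (2 * c) : ℝ) : ℂ) := by
      push_cast; ring
    have hs0 : Complex.sinh ((-(ξ - η) / (2 * c) : ℝ) : ℂ) ≠ 0 := by
      rw [← Complex.ofReal_sinh, Complex.ofReal_ne_zero, Ne, Real.sinh_eq_zero]
      exact div_ne_zero (neg_ne_zero.2 hζ) (by positivity)
    have hlim : (c : ℂ)⁻¹ * (2 * Complex.sinh ((-(ξ - η) / (2 * c) : ℝ) : ℂ))⁻¹ * (g
        * ((coefS μ a ^ 2 - μ ^ 2 * coefC μ c₀ a ^ 2) / (a ^ 2 - μ ^ 2)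
        * sinhDiv μ (Real.log (Real.exp (-(ξ - η) / c)))))
        = sinhDiv μ (((ξ - η) / c : ℝ) : ℂ)
          / (2 * Complex.sinh (((ξ - η) / (2 * c) : ℝ) : ℂ)) := by
      rw [← mul_assoc g, hD, Real.log_exp, e1, e2, sinhDiv_neg, Complex.sinh_neg]
      field_simp
    rw [hlim] at t
    refine t.congr fun M => ?_
    have hne : expVar c (ξ + M) ≠ expVar c (η + M) := by
      intro he
      have := Real.exp_injective he
      rw [div_left_inj' hc.ne'] at this
      exact hξ (by linarith)
    rw [divDiffKernel, if_neg hne, sqrt_expVar_mul hc, ← Complex.ofReal_sub, expVar_sub_expVar hc,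
      add_sub_add_right_eq_sub]
    have he0 : ((Real.exp (-(ξ + M + (η + M)) / (2 * c)) : ℝ) : ℂ) ≠ 0 :=
      Complex.ofReal_ne_zero.2 (Real.exp_pos _).ne'
    rw [← Complex.ofReal_sinh] at hs0 ⊢
    rw [Complex.ofReal_mul, Complex.ofReal_mul, Complex.ofReal_div]
    push_cast at he0 hs0 ⊢
    field_simp

/-- The limit of the off-diagonal block, without its constant factor. -/
def crossLimit (μ a : ℂ) (c ζ : ℝ) : ℂ :=
  (crossC μ a * Complex.cosh (μ * ((ζ / c : ℝ) : ℂ))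
    - Complex.sin (Real.pi * a) * Complex.cos (Real.pi * μ) * sinRatio μ
      * sinhDiv μ ((ζ / c : ℝ) : ℂ)) / (2 * c * Complex.cosh ((ζ / (2 * c) : ℝ) : ℂ))

theorem WhittakerPair.tendsto_offDiag {μ c₀ a : ℂ} {A B A' B' : ℝ → ℂ}
    (h : WhittakerPair μ c₀ a A B) (h' : WhittakerPair μ c₀ (-a) A' B')
    (h1 : -1 / 2 < μ.re) (h2 : μ.re < 1 / 2) (h0 : a ^ 2 - μ ^ 2 ≠ 0) {c : ℝ} (hc : 0 < c)
    (ξ η : ℝ) :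
    Tendsto (fun M : ℝ => ((Real.sqrt (expVar c (ξ + M) / c) * Real.sqrt (expVar c (η + M) / c) : ℝ)
      : ℂ) * ((A (expVar c (ξ + M)) * A' (expVar c (η + M)) + (a ^ 2 - μ ^ 2)
        * (B (expVar c (ξ + M)) * B' (expVar c (η + M))))
        / ((expVar c (ξ + M) : ℂ) + (expVar c (η + M) : ℂ)))) atTop
      (𝓝 (crossLimit μ a c (ξ - η))) := by
  have hc0 : (c : ℂ) ≠ 0 := Complex.ofReal_ne_zero.2 hc.ne'
  have t := (h.tendsto_cross h' h1 h2 h0 (Real.exp_pos _) (tendsto_expVar hc ξ)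
      (tendsto_expVar hc η) (fun M => expVar_eq_mul)).const_mul
      ((2 * c * Complex.cosh ((-(ξ - η) / (2 * c) : ℝ) : ℂ))⁻¹)
  have e1 : (((-(ξ - η) / c : ℝ)) : ℂ) = -(((ξ - η) / c : ℝ) : ℂ) := by push_cast; ring
  have e2 : (((-(ξ - η) / (2 * c) : ℝ)) : ℂ) = -(((ξ - η) / (2 * c) : ℝ) : ℂ) := by
    push_cast; ring
  rw [Real.log_exp, e1, e2, sinhDiv_neg, Complex.cosh_neg, mul_neg, mul_neg, ← sub_eq_add_neg,
    Complex.cosh_neg, inv_mul_eq_div] at t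
  refine t.congr fun M => ?_
  rw [sqrt_expVar_mul hc, ← Complex.ofReal_add, expVar_add_expVar hc, add_sub_add_right_eq_sub]
  have he0 : ((Real.exp (-(ξ + M + (η + M)) / (2 * c)) : ℝ) : ℂ) ≠ 0 :=
    Complex.ofReal_ne_zero.2 (Real.exp_pos _).ne'
  have hs0 : ((Real.cosh (-(ξ - η) / (2 * c)) : ℝ) : ℂ) ≠ 0 :=
    Complex.ofReal_ne_zero.2 (Real.cosh_pos _).ne'
  rw [← Complex.cosh_neg ((((ξ - η) / (2 * c) : ℝ)) : ℂ), ← e2, ← Complex.ofReal_cosh,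
    Complex.ofReal_mul, Complex.ofReal_mul, Complex.ofReal_div]
  push_cast at he0 hs0 ⊢
  field_simp

/-! ### Closed forms of the limits -/

theorem scaleComplex_eq (z z' : ℂ) : scaleComplex z z'
    = sinRatio (parMu z z') * (sigma z z' : ℂ) ^ 2 / Real.pi := by
  rw [scaleComplex, sinRatio]
  split_ifs with h
  · field_simp
  · simp only [div_eq_mul_inv, mul_inv]
    ring

theorem constBComplex_eq (z z' : ℂ) : constBComplex z z' = 1 / (2 * scaleComplex z z') := by
  rw [scaleComplex, constBComplex]
  split_ifs with h
  · field_simp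
  · simp only [div_eq_mul_inv, mul_inv, inv_inv]
    ring

theorem constA_eq (z z' : ℂ) : constA z z' = 2 * parMu z z' * constBComplex z z' := by
  rw [constA, constBComplex]
  split_ifs with h
  · simp [h]
  · have h2 : parMu z z' * (parMu z z')⁻¹ = 1 := mul_inv_cancel₀ h
    simp only [div_eq_mul_inv, mul_inv]
    linear_combination (-(Real.pi : ℂ) * Complex.sin (2 * Real.pi * parMu z z') * 2⁻¹
      * ((sigma z z' : ℂ) ^ 2)⁻¹) * h2

/-- Everything rests on `B = 1/(2c)` and `A = μ/c`. -/
theorem tailF_eq_diagLimit {z z' : ℂ} (hB : (constB z z' : ℂ) = constBComplex z z')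
    (hc : 0 < scale z z') (hc' : (scale z z' : ℂ) = scaleComplex z z') (ζ : ℝ) :
    tailF z z' ζ = diagLimit (parMu z z') (scale z z') ζ := by
  have hc0 : (scale z z' : ℂ) ≠ 0 := Complex.ofReal_ne_zero.2 hc.ne'
  have hB' : (constB z z' : ℂ) = 1 / (2 * scale z z') := by rw [hB, constBComplex_eq, hc']
  have hA : constA z z' = parMu z z' / scale z z' := by
    rw [constA_eq, ← hB, hB']
    field_simp
  have e1 : (constB z z' : ℂ) * ζ = ((ζ / (2 * scale z z') : ℝ) : ℂ) := by
    rw [hB']; push_cast; ring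
  rw [tailF, diagLimit]
  split_ifs with h0 hμ
  · rfl
  · rw [e1, sinhDiv, if_pos hμ]
    push_cast
    field_simp
  · rw [e1, hA, hB', sinhDiv, if_neg hμ, show parMu z z' / (scale z z' : ℂ) * ζ
      = parMu z z' * ((ζ / scale z z' : ℝ) : ℂ) by push_cast; ring]
    field_simp

theorem tailG_eq_crossLimit {z z' : ℂ} (hB : (constB z z' : ℂ) = constBComplex z z')
    (hc : 0 < scale z z') (hc' : (scale z z' : ℂ) = scaleComplex z z') (hσ : 0 < sigma z z')
    (ζ : ℝ) : tailG z z' ζ = (sigma z z' : ℂ) / Real.pi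
      * crossLimit (parMu z z') (parA z z') (scale z z') ζ := by
  have hc0 : (scale z z' : ℂ) ≠ 0 := Complex.ofReal_ne_zero.2 hc.ne'
  have hσ0 : (sigma z z' : ℂ) ≠ 0 := Complex.ofReal_ne_zero.2 hσ.ne'
  have hπ := pi_ne_zero'
  have hB' : (constB z z' : ℂ) = 1 / (2 * scale z z') := by rw [hB, constBComplex_eq, hc']
  have hA : constA z z' = parMu z z' / scale z z' := by
    rw [constA_eq, ← hB, hB']
    field_simp
  have e1 : (constB z z' : ℂ) * ζ = ((ζ / (2 * scale z z') : ℝ) : ℂ) := by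
    rw [hB']; push_cast; ring
  have hr : sinRatio (parMu z z') = Real.pi * scale z z' / (sigma z z' : ℂ) ^ 2 := by
    rw [hc', scaleComplex_eq]
    field_simp
  have hch : Complex.cosh ((ζ / (2 * scale z z') : ℝ) : ℂ) ≠ 0 := by
    rw [← Complex.ofReal_cosh]
    exact Complex.ofReal_ne_zero.2 (Real.cosh_pos _).ne'
  rw [tailG, crossLimit, crossC]
  split_ifs with hμ
  · have hr' : (scale z z' : ℂ) = (sigma z z' : ℂ) ^ 2 / (Real.pi : ℂ) ^ 2 := by
      rw [hc', scaleComplex, if_pos hμ]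
    rw [mul_assoc 2 (constB z z' : ℂ), e1, sinhDiv, if_pos hμ, hr]
    simp only [hμ, zero_mul, mul_zero, Complex.cosh_zero, Complex.cos_zero]
    generalize Complex.cosh ((ζ / (2 * scale z z') : ℝ) : ℂ) = w at hch ⊢
    push_cast
    rw [hr']
    field_simp
  · rw [e1, hA, sinhDiv, if_neg hμ, hr, show parMu z z' / (scale z z' : ℂ) * ζ
      = parMu z z' * ((ζ / scale z z' : ℝ) : ℂ) by push_cast; ring]
    field_simp

end WhittakerTail

end

/-! ### Assembly of the matrix limit -/

open WhittakerTail

theorem mainTheorem6 (z z' : ℂ) (h : WhittakerTail.Admissible z z') :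
    (0 < WhittakerTail.sigma z z' ∧
      (WhittakerTail.sigma z z' : ℂ) ^ 2 = WhittakerTail.sinProd z z') ∧
    (0 < WhittakerTail.scale z z' ∧
      (WhittakerTail.scale z z' : ℂ) = WhittakerTail.scaleComplex z z') ∧
    (0 < WhittakerTail.constB z z' ∧
      (WhittakerTail.constB z z' : ℂ) = WhittakerTail.constBComplex z z') ∧
    WhittakerTail.constA z z' = 2 * WhittakerTail.parMu z z' * WhittakerTail.constB z z' ∧
    ∃ 𝒦 : ℝ → ℝ → Matrix (Fin 2) (Fin 2) ℂ,
      (∀ ξ η : ℝ, Tendsto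
        (fun M : ℝ => WhittakerTail.whittakerKernelLog z z' (ξ + M) (η + M))
        atTop (𝓝 (𝒦 ξ η))) ∧
      (∀ ξ η s : ℝ, 𝒦 (ξ + s) (η + s) = 𝒦 ξ η) ∧
      (∀ ξ : ℝ, 𝒦 ξ ξ 0 0 = 1 ∧ 𝒦 ξ ξ 1 1 = 1) ∧
      (∀ ξ η : ℝ, 𝒦 ξ η =
        !![WhittakerTail.tailF z z' (ξ - η), WhittakerTail.tailG z z' (ξ - η);
           -WhittakerTail.tailG z z' (η - ξ), WhittakerTail.tailF z z' (ξ - η)]) := by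
  obtain ⟨a, s, r, hs, hr, ha, h1, h2, hz0, hsP, hrP⟩ := h.exists_params
  have hσ : 0 < sigma z z' := by
    rw [sigma, hsP, Complex.ofReal_re]
    exact Real.sqrt_pos.2 hs
  have hσ2 : (sigma z z' : ℂ) ^ 2 = sinProd z z' := by
    rw [sigma, hsP, Complex.ofReal_re, ← Complex.ofReal_pow, Real.sq_sqrt hs.le]
  have hsc : scaleComplex z z' = ((r * s / Real.pi : ℝ) : ℂ) := by
    rw [scaleComplex_eq, hσ2, hsP, hrP]; push_cast; rfl
  have hsc' : (scale z z' : ℂ) = scaleComplex z z' := by rw [scale, hsc, Complex.ofReal_re]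
  have hc : 0 < scale z z' := by
    rw [scale, hsc, Complex.ofReal_re]; positivity
  have hBc : constBComplex z z' = ((1 / (2 * scale z z') : ℝ) : ℂ) := by
    rw [constBComplex_eq, ← hsc']; push_cast; rfl
  have hB' : (constB z z' : ℂ) = constBComplex z z' := by rw [constB, hBc, Complex.ofReal_re]
  have hB : 0 < constB z z' := by
    rw [constB, hBc, Complex.ofReal_re]; positivity
  refine ⟨⟨hσ, hσ2⟩, ⟨hc, hsc'⟩, ⟨hB, hB'⟩, by rw [hB', constA_eq], ?_⟩
  refine ⟨fun ξ η => !![tailF z z' (ξ - η), tailG z z' (ξ - η);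
    -tailG z z' (η - ξ), tailF z z' (ξ - η)], ?_, ?_, ?_, fun _ _ => rfl⟩
  · intro ξ η
    have hz : z = a + parMu z z' := by rw [← ha, parA, parMu]; ring
    have hz' : z' = a - parMu z z' := by rw [← ha, parA, parMu]; ring
    have hzz : (a : ℂ) ^ 2 - parMu z z' ^ 2 = z * z' := by
      rw [← ha, parA, parMu]; ring
    have hne : (a : ℂ) ^ 2 - parMu z z' ^ 2 ≠ 0 := by rw [hzz]; exact hz0
    have hnen : ((-a : ℝ) : ℂ) ^ 2 - parMu z z' ^ 2 ≠ 0 := by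
      rw [Complex.ofReal_neg, neg_sq]; exact hne
    obtain ⟨A, B, hP⟩ := exists_whittakerPair h1 h2 (a : ℂ)
    obtain ⟨A', B', hP'⟩ := exists_whittakerPair h1 h2 ((-a : ℝ) : ℂ)
    have hAp : ∀ x : ℝ, 0 < x → Aplus z z' x = A x := fun x hx => by
      rw [Aplus, ha]; exact hP.inv_sqrt_mul_whittakerW_fst hx
    have hBp : ∀ x : ℝ, 0 < x → Bplus z z' x = B x := fun x hx => by
      rw [Bplus, ha]; exact hP.inv_sqrt_mul_whittakerW_snd hx
    have hAm : ∀ x : ℝ, 0 < x → Aminus z z' x = A' x := fun x hx => by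
      rw [Aminus, ha, ← Complex.ofReal_neg]; exact hP'.inv_sqrt_mul_whittakerW_fst hx
    have hBm : ∀ x : ℝ, 0 < x → Bminus z z' x = B' x := fun x hx => by
      rw [Bminus, ha, ← Complex.ofReal_neg]; exact hP'.inv_sqrt_mul_whittakerW_snd hx
    have hprod : Complex.sin (Real.pi * z) * Complex.sin (Real.pi * z') = sinProd z z' := rfl
    have hg : 1 / (Complex.Gamma z * Complex.Gamma z') * (coefS (parMu z z') a ^ 2
        - parMu z z' ^ 2 * coefC (parMu z z') logConst a ^ 2)
        = ((a : ℂ) ^ 2 - parMu z z' ^ 2) * scale z z' := by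
      have e := coef_disc (parMu z z') logConst a
      rw [← hz, ← hz', hprod, ← hσ2, ← scaleComplex_eq, ← hsc'] at e
      rw [← e, rGamma, rGamma, one_div, mul_inv]
    have hg' : 1 / (Complex.Gamma (-z) * Complex.Gamma (-z'))
        * (coefS (parMu z z') ((-a : ℝ) : ℂ) ^ 2
        - parMu z z' ^ 2 * coefC (parMu z z') logConst ((-a : ℝ) : ℂ) ^ 2)
        = (((-a : ℝ) : ℂ) ^ 2 - parMu z z' ^ 2) * scale z z' := by
      have e := coef_disc (parMu z z') logConst ((-a : ℝ) : ℂ)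
      -- Passing from `a` to `-a` with `μ` unchanged sends `(z, z')` to `(-z', -z)`; the product of
      -- sines is unaffected.
      rw [show ((-a : ℝ) : ℂ) + parMu z z' = -z' by push_cast; linear_combination hz',
        show ((-a : ℝ) : ℂ) - parMu z z' = -z by push_cast; linear_combination hz,
        mul_neg, mul_neg, Complex.sin_neg, Complex.sin_neg, neg_mul_neg, mul_comm (Complex.sin _),
        hprod, ← hσ2, ← scaleComplex_eq, ← hsc'] at e
      rw [← e, rGamma, rGamma, one_div, mul_inv]
      ring
    have tF := hP.tendsto_diag h1 h2 hne hc hg ξ η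
    have tF' := hP'.tendsto_diag h1 h2 hnen hc hg' ξ η
    rw [Complex.ofReal_neg] at hP'
    have tG := ((hP.tendsto_offDiag hP' h1 h2 hne hc ξ η).const_mul
      ((sigma z z' : ℂ) / Real.pi))
    -- The lower left block is minus the upper right one with arguments exchanged, so the same limit
    -- is used at `(η, ξ)`.
    have tG' := ((hP.tendsto_offDiag hP' h1 h2 hne hc η ξ).const_mul
      ((sigma z z' : ℂ) / Real.pi)).neg
    rw [← ha, ← tailG_eq_crossLimit hB' hc hsc' hσ] at tG tG'
    rw [← tailF_eq_diagLimit hB' hc hsc'] at tF tF'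
    have px := fun M => expVar_pos (scale z z') (ξ + M)
    have py := fun M => expVar_pos (scale z z') (η + M)
    refine tendsto_pi_nhds.2 fun i => tendsto_pi_nhds.2 fun j => ?_
    fin_cases i <;> fin_cases j
    · refine tF.congr fun M => ?_
      rw [← divDiffKernel_congr hAp hBp (px M) (py M)]
      rfl
    · refine tG.congr fun M => ?_
      simp only [whittakerKernelLog, whittakerKernel, Kpm, ← hAp _ (px M), ← hBp _ (px M),
        ← hAm _ (py M), ← hBm _ (py M), ha, hzz, Matrix.smul_apply, smul_eq_mul, Fin.zero_eta,
        Fin.mk_one, Matrix.of_apply, Matrix.cons_val_zero, Matrix.cons_val_one,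
        Matrix.cons_val_fin_one]
      ring
    · refine tG'.congr fun M => ?_
      simp only [whittakerKernelLog, whittakerKernel, Kmp, ← hAp _ (py M), ← hBp _ (py M),
        ← hAm _ (px M), ← hBm _ (px M), ha, hzz, Matrix.smul_apply, smul_eq_mul, Fin.zero_eta,
        Fin.mk_one, Matrix.of_apply, Matrix.cons_val_zero, Matrix.cons_val_one,
        Matrix.cons_val_fin_one]
      rw [add_comm (expVar (scale z z') (η + M) : ℂ), mul_comm (Real.sqrt _) (Real.sqrt _)]
      ring
    · refine tF'.congr fun M => ?_
      rw [← divDiffKernel_congr hAm hBm (px M) (py M)]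
      rfl
  · intro ξ η s
    simp only [add_sub_add_right_eq_sub]
  · intro ξ
    simp [tailF]
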